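/- **Setting.** Let $\Theta\subseteq\mathbb R^{d_\pi}\times\mathbb R^{d_\beta}$ be contained in an open set $\breve\Theta$, let $\tau:\breve\Theta\to\mathbb R^{d_\tau}$, and let $\delta(\pi,\beta)=(\pi,\tau(\pi,\beta))\in\mathbb R^{d_\delta}$, $d_\delta=d_\pi+d_\tau$. For every $n$ let $P_n$ be the distribution of the data when the true parameter is $\theta_n=(\pi_n,\beta_n)\in\Theta$, where $\theta_n\to\theta_*=(\pi_*,\beta_*)$; let $Q_n$ be a data-dependent real function on $\breve\Theta$; and let the estimator $\hat\theta_n=(\hat\pi_n,\hat\beta_n)$ be a random vector in $\Theta$ with $Q_n(\hat\theta_n)\le\inf_{\theta\in\Theta}Q_n(\theta)+o_p(n^{-1})$. Write $\delta_n=\delta(\theta_n)$, $\delta_*=\delta(\theta_*)$, $\mathcal B(\Pi)=\{\beta: (\pi,\beta)\in\Theta\text{ for some }\pi\in\Pi\}$, $\mathcal B(\pi)=\mathcal B(\{\pi\})$, $\mathcal B_*=\mathcal B(\pi_*)$. Limits are as $n\to\infty$, and probabilities are under $P_n$ (outer probabilities where measurability is not given). **General assumptions.** 1. $\tau$ is twice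 continuously differentiable on $\breve\Theta$. 2. $T_n$ is a data-dependent real function, almost surely twice differentiable at every point of $\delta(\breve\Theta)$, with $\sup_{\theta\in\breve\Theta}|Q_n(\theta)-T_n(\delta(\theta))|=o_p(1)$ and, for all positive $\eta_n\to0$, $\displaystyle\sup_{\theta\in\breve\Theta:\|\delta(\theta)-\delta_n\|\le\eta_n}\frac{|Q_n(\theta)-T_n(\delta(\theta))|}{(1+\sqrt n\|\delta(\theta)-\delta_n\|)^2}=o_p(n^{-1})$. 3. There is a nonstochastic real function $T$, continuous on $\delta(\breve\Theta)$, with $\sup_{\delta\in\delta(\breve\Theta)}|T_n(\delta)-T(\delta)|\to_p0$ and $\inf_{\delta\in\delta(\breve\Theta)\setminus U}T(\delta)-T(\delta_*)>0$ for every neighborhood $U$ of $\delta_*$. 4. $\Theta$ is closed, $\mathcal B_*$ is compact, and for some $M>0$ the Hausdorff distance satisfies $d_H(\mathcal B(\pi_1),\mathcal B(\pi_2))\le M\|\pi_1-\pi_2\|$ for all $\pi_1,\pi_2$ in a neighborhood of $\pi_*$. 5. With $R_n(\delta)=T_n(\delta)-T_n(\delta_n)-\partial_\delta T_n(\delta_n)'(\delta-\delta_n)-\tfrac12(\delta-\delta_n)'\partial_{\delta\delta}T_n(\delta_n)(\delta-\delta_n)$,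 for all positive $\eta_n\to0$, $\displaystyle\sup_{\delta\in\delta(\breve\Theta):\|\delta-\delta_n\|\le\eta_n}\frac{|nR_n(\delta)|}{(1+\sqrt n\|\delta-\delta_n\|)^2}=o_p(1)$. 6. $\sqrt n\,\partial_\delta T_n(\delta_n)\to_dY\sim N(0,V)$ and $\partial_{\delta\delta}T_n(\delta_n)\to_pH$, with $V,H$ symmetric positive definite. **Identification regimes.** In the semi-strong and weak regimes, $\mathcal B_1=\mathcal B(\Pi_1)$, where $\Pi_1$ is a neighborhood of $\pi_*$ with $\mathcal B(\Pi_1)$ compact and $\Pi_1\times\mathcal B(\Pi_1)\subseteq\breve\Theta$. - *Strong:* for $\beta\in\mathcal B_*$, $\tau(\pi_*,\beta)=\tau(\pi_*,\beta_*)$ implies $\beta=\beta_*$; and $C:=\partial_\beta\tau(\theta_*)$ has rank $d_\beta$. Put $a_n=1$. - *Semi-strong:* for positive constants $a_n\to\infty$ with $a_n/\sqrt n\to0$: $a_n(\tau(\pi_n,\beta)-\tau(\pi_n,\beta_n))\to c(\beta)$ uniformly over $\beta\in\mathcal B_1$, where $c(\beta)=0$ implies $\beta=\beta_*$; and $a_n\partial_\beta\tau(\pi_n,\beta)\to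 C(\beta)$ uniformly over a neighborhood of $\beta_*$, where $C:=C(\beta_*)$ has rank $d_\beta$. - *Weak:* $\sqrt n(\tau(\pi_n,\beta)-\tau(\pi_n,\beta_n))\to c(\beta)$ uniformly over $\beta\in\mathcal B_1$. **Limit objects.** In the strong and semi-strong regimes let $D_*=\begin{pmatrix}I&0\\\partial_\pi\tau(\theta_*)&C\end{pmatrix}$, $J=D_*'HD_*$, $Z=-J^{-1}D_*'Y$ and $q^S(\psi)=(Z-\psi)'J(Z-\psi)/2-Z'JZ/2$. In the weak regime let $D_1(\beta)=\begin{pmatrix}I\\\partial_\pi\tau(\pi_*,\beta)\end{pmatrix}$, $J_{11}(\beta)=D_1(\beta)'HD_1(\beta)$, $g(\beta)=(0,c(\beta))$, $Z_1(\beta)=-J_{11}(\beta)^{-1}D_1(\beta)'(Y+Hg(\beta))$, $\tilde q^W(\beta)=g(\beta)'Hg(\beta)/2+Y'g(\beta)-Z_1(\beta)'J_{11}(\beta)Z_1(\beta)/2$ and $q^W(\psi_1,\beta)=(Z_1(\beta)-\psi_1)'J_{11}(\beta)(Z_1(\beta)-\psi_1)/2+\tilde q^W(\beta)$. For sets put $\vec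 d(A,B)=\max(\sup_{a\in A}\inf_{b\in B}d(a,b),0)$; $\Psi_n\to_K\Psi$ (Kuratowski) means that $\max(\vec d(\Psi_n\cap K,\Psi),\vec d(\Psi\cap K,\Psi_n))\to0$ for every compact $K$. **Theorem.** Let the general assumptions hold. (a), (b) In the strong regime (with $a_n=1$), and in the semi-strong regime, suppose that $\{(\sqrt n(\pi-\pi_n),\sqrt n(\beta-\beta_n)/a_n):(\pi,\beta)\in\Theta\}\to_K\Psi$ for a closed convex set $\Psi$. Then $q^S$ has a unique minimizer over $\Psi$ and $$\begin{pmatrix}\sqrt n(\hat\pi_n-\pi_n)\\\sqrt n(\hat\beta_n-\beta_n)/a_n\end{pmatrix}\to_d\operatorname*{argmin}_{\psi\in\Psi}q^S(\psi).$$ (c) In the weak regime, suppose that almost surely $\tilde q^W$ has a unique minimizer $\beta_{\mathrm{MIN}}$ over $\mathcal B_*$. Then, almost surely, $(Z_1(\beta_{\mathrm{MIN}}),\beta_{\mathrm{MIN}})$ is the unique minimizer of $q^W$ over $\mathbb R^{d_\pi}\times\mathcal B_*$, and $$\begin{pmatrix}\sqrt n(\hat\pi_n-\pi_n)\\\hat\beta_n\end{pmatrix}\to_d\begin{pmatrix}Z_1(\beta_{\mathrm{MIN}})\\\beta_{\mathrm{MIN}}\end{pmatrix}=\operatorname*{argmin}_{(\psi_1,\beta)\in\mathbb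 R^{d_\pi}\times\mathcal B_*}q^W(\psi_1,\beta).$$ -/

import Mathlib

open Filter Topology MeasureTheory ProbabilityTheory Matrix
open scoped ENNReal

noncomputable section

namespace MinDist

/-- The Euclidean space of column vectors indexed by `ι`. -/
abbrev Vec (ι : Type*) : Type _ := EuclideanSpace ℝ ι

/-- The space of pairs `(π, β)`, and of local parameters `(ψ₁, ψ₂)`, with `π ∈ ℝ^p` and `β ∈ ℝ^q`.
Only notions that do not depend on the choice of a norm on `ℝ^p × ℝ^q` are used on it. -/
abbrev Param (p q : ℕ) : Type := Vec (Fin p) × Vec (Fin q)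

/-- Stacking of two column vectors. -/
def stack {p r : ℕ} (a : Vec (Fin p)) (b : Vec (Fin r)) : Vec (Fin p ⊕ Fin r) :=
  WithLp.toLp 2 (Sum.elim a.ofLp b.ofLp)

/-- Coordinates of a pair, as one column. -/
def col {p q : ℕ} (x : Param p q) : Fin p ⊕ Fin q → ℝ := Sum.elim x.1.ofLp x.2.ofLp

/-- Directed distance `max (sup_{a ∈ A} inf_{b ∈ B} d(a, b), 0)`, with values in `[0, ∞]`. -/
def dirDist {X : Type*} [PseudoEMetricSpace X] (A B : Set X) : ℝ≥0∞ :=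
  ⨆ a ∈ A, Metric.infEDist a B

/-- Kuratowski convergence of a sequence of sets. -/
def KuratowskiTendsto {X : Type*} [PseudoEMetricSpace X] (A : ℕ → Set X) (B : Set X) : Prop :=
  ∀ K : Set X, IsCompact K →
    Tendsto (fun n => max (dirDist (A n ∩ K) B) (dirDist (B ∩ K) (A n))) atTop (𝓝 0)

/-- `x` is the unique minimizer of `f` over `S`, that is `argmin_S f = x`. -/
def IsUniqueMin {X : Type*} (f : X → ℝ) (S : Set X) (x : X) : Prop :=
  x ∈ S ∧ ∀ y ∈ S, y ≠ x → f x < f y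

/-- `X n = o_p(1)` for `[0, ∞]`-valued `X n` on varying probability spaces. No measurability is
asked for: on sets that are not measurable `P n` is the outer probability. -/
def NegligibleInProb {Ω : ℕ → Type*} [∀ n, MeasurableSpace (Ω n)] (P : ∀ n, Measure (Ω n))
    (X : ∀ n, Ω n → ℝ≥0∞) : Prop :=
  ∀ ε : ℝ≥0∞, 0 < ε → Tendsto (fun n => P n {ω | ε ≤ X n ω}) atTop (𝓝 0)

/-- The matrix of first derivatives of `f` at `x`; row `i` belongs to the component `f_i`. -/
def jacobian {ι κ : Type*} [Fintype ι] [DecidableEq ι] [Fintype κ] (f : Vec ι → Vec κ) (x : Vec ι) :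
    Matrix κ ι ℝ :=
  Matrix.of fun i j => (fderiv ℝ f x (EuclideanSpace.single j 1)).ofLp i

/-- The matrix of second derivatives of a real-valued `f` at `x`. -/
def hessian {ι : Type*} [Fintype ι] [DecidableEq ι] (f : Vec ι → ℝ) (x : Vec ι) : Matrix ι ι ℝ :=
  Matrix.of fun i j =>
    fderiv ℝ (fderiv ℝ f) x (EuclideanSpace.single j 1) (EuclideanSpace.single i 1)

/-- `f` is twice differentiable at `x`. -/
def TwiceDifferentiableAt {ι : Type*} [Fintype ι] (f : Vec ι → ℝ) (x : Vec ι) : Prop :=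
  (∀ᶠ y in 𝓝 x, DifferentiableAt ℝ f y) ∧ DifferentiableAt ℝ (fderiv ℝ f) x

/-- The data of a minimum distance problem along a sequence of true parameters, with
`d_π = p`, `d_β = q`, `d_τ = r`. `Ω n` carries the sample of size `n`, and `P n` is the distribution
of the data at the true parameter of index `n`. Functions are total; their values outside their
domains (`big` for `τ` and `Q n ω`) play no role. -/
structure Model (p q r : ℕ) (Ω : ℕ → Type*) [∀ n, MeasurableSpace (Ω n)] where
  /-- the distribution of the data -/
  P : ∀ n, Measure (Ω n)
  isProb : ∀ n, IsProbabilityMeasure (P n)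
  /-- the parameter space `Θ` -/
  space : Set (Param p q)
  /-- the larger set on which the functions are defined -/
  big : Set (Param p q)
  /-- the component `τ` of the link function -/
  τ : Param p q → Vec (Fin r)
  /-- the objective function -/
  Q : ∀ n, Ω n → Param p q → ℝ
  /-- the estimator -/
  est : ∀ n, Ω n → Param p q
  /-- the true parameters `θ_n = (π_n, β_n)` -/
  θ : ℕ → Param p q
  /-- the limit `θ_* = (π_*, β_*)` of the true parameters -/
  θlim : Param p q

namespace Model

variable {p q r : ℕ} {Ω : ℕ → Type*} [∀ n, MeasurableSpace (Ω n)] (M : Model p q r Ω)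

instance (n : ℕ) : IsProbabilityMeasure (M.P n) := M.isProb n

/-- The link function `δ(π, β) = (π, τ(π, β))`. -/
def δ (x : Param p q) : Vec (Fin p ⊕ Fin r) := stack x.1 (M.τ x)

/-- The set `δ(Θ̆)` of reduced-form parameters. -/
def reduced : Set (Vec (Fin p ⊕ Fin r)) := M.δ '' M.big

/-- The cross-section `B(Π) = {β | (π, β) ∈ Θ for some π ∈ Π}`. -/
def crossSection (S : Set (Vec (Fin p))) : Set (Vec (Fin q)) := {b | ∃ a ∈ S, (a, b) ∈ M.space}

/-- The identified set `B_* = B({π_*})`. -/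
def identified : Set (Vec (Fin q)) := M.crossSection {M.θlim.1}

/-- `∂_π τ(x)`. -/
def jacPi (x : Param p q) : Matrix (Fin r) (Fin p) ℝ := jacobian (fun a => M.τ (a, x.2)) x.1

/-- `∂_β τ(x)`. -/
def jacBeta (x : Param p q) : Matrix (Fin r) (Fin q) ℝ := jacobian (fun b => M.τ (x.1, b)) x.2

/-- The standing framework: `Θ ⊆ Θ̆` with `Θ̆` open, true parameters in `Θ` that converge, and a
random vector in `Θ` with `Q_n(est) ≤ inf_Θ Q_n + o_p(1/n)`. -/
structure Framework : Prop where
  isOpen_big : IsOpen M.big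
  space_subset : M.space ⊆ M.big
  θ_mem : ∀ n, M.θ n ∈ M.space
  θ_tendsto : Tendsto M.θ atTop (𝓝 M.θlim)
  est_measurable : ∀ n, Measurable (M.est n)
  est_mem : ∀ n ω, M.est n ω ∈ M.space
  est_min : NegligibleInProb M.P fun n ω =>
    ⨆ x ∈ M.space, ENNReal.ofReal (n * (M.Q n ω (M.est n ω) - M.Q n ω x))

/-- `τ` is twice continuously differentiable. -/
def SmoothLink : Prop := ContDiffOn ℝ 2 M.τ M.big

/-- The objective function depends on `θ` approximately only through `δ(θ)`. Since `δ(Θ̆)` need not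
be open, `T n ω` is a function on the whole space that is twice differentiable at the points of
`δ(Θ̆)`; its values away from `δ(Θ̆)` enter only through its derivatives at `δ_n`. -/
structure ReducedFormObjective (T : ∀ n, Ω n → Vec (Fin p ⊕ Fin r) → ℝ) : Prop where
  twice_diff : ∀ n, ∀ᵐ ω ∂(M.P n), ∀ d ∈ M.reduced, TwiceDifferentiableAt (T n ω) d
  unif : NegligibleInProb M.P fun n ω =>
    ⨆ x ∈ M.big, ENNReal.ofReal |M.Q n ω x - T n ω (M.δ x)|
  local_unif : ∀ η : ℕ → ℝ, (∀ n, 0 < η n) → Tendsto η atTop (𝓝 0) →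
    NegligibleInProb M.P fun n ω =>
      ⨆ x ∈ M.big, ⨆ _ : ‖M.δ x - M.δ (M.θ n)‖ ≤ η n,
        ENNReal.ofReal (n * (|M.Q n ω x - T n ω (M.δ x)|
          / (1 + √n * ‖M.δ x - M.δ (M.θ n)‖) ^ 2))

/-- The reduced-form parameters are identified and consistently estimable. -/
def ReducedFormIdentified (T : ∀ n, Ω n → Vec (Fin p ⊕ Fin r) → ℝ) : Prop :=
  ∃ T₀ : Vec (Fin p ⊕ Fin r) → ℝ, ContinuousOn T₀ M.reduced ∧
    NegligibleInProb M.P (fun n ω => ⨆ d ∈ M.reduced, ENNReal.ofReal |T n ω d - T₀ d|) ∧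
    ∀ U ∈ 𝓝 (M.δ M.θlim), ∃ c > 0, ∀ d ∈ M.reduced \ U, c ≤ T₀ d - T₀ (M.δ M.θlim)

/-- Shape of the parameter space: `Θ` is closed, `B_*` is compact and `B(π)` is locally Lipschitz
in the Hausdorff distance near `π_*`. -/
structure RegularSpace : Prop where
  isClosed : IsClosed M.space
  isCompact : IsCompact M.identified
  lipschitz : ∃ L > 0, ∃ N ∈ 𝓝 M.θlim.1, ∀ a₁ ∈ N, ∀ a₂ ∈ N,
    Metric.hausdorffEDist (M.crossSection {a₁}) (M.crossSection {a₂}) ≤ ENNReal.ofReal (L * ‖a₁ - a₂‖)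

/-- `S` is a neighborhood of `π_*` with `B(S)` compact and `S × B(S) ⊆ Θ̆`. The set `B(S)` is the
one over which limits that are uniform in `β` are taken. -/
structure BaseNhd (S : Set (Vec (Fin p))) : Prop where
  mem_nhds : S ∈ 𝓝 M.θlim.1
  isCompact : IsCompact (M.crossSection S)
  prod_subset : S ×ˢ M.crossSection S ⊆ M.big

/-- Strong sequences. -/
structure Strong : Prop where
  injective : ∀ b ∈ M.identified, M.τ (M.θlim.1, b) = M.τ M.θlim → b = M.θlim.2
  rank : (M.jacBeta M.θlim).rank = q

/-- Semi-strong sequences, with rate `a`, limit functions `c`, `C`, and `B(S)` as set of `β`. -/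
structure SemiStrong (a : ℕ → ℝ) (S : Set (Vec (Fin p))) (c : Vec (Fin q) → Vec (Fin r))
    (C : Vec (Fin q) → Matrix (Fin r) (Fin q) ℝ) : Prop where
  pos : ∀ n, 0 < a n
  unbounded : Tendsto a atTop atTop
  slow : Tendsto (fun n : ℕ => a n / √n) atTop (𝓝 0)
  unif : TendstoUniformlyOn (fun n b => a n • (M.τ ((M.θ n).1, b) - M.τ (M.θ n))) c atTop
    (M.crossSection S)
  injective : ∀ b ∈ M.crossSection S, c b = 0 → b = M.θlim.2
  unif_deriv : ∃ N ∈ 𝓝 M.θlim.2, ∀ i j,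
    TendstoUniformlyOn (fun n b => a n * M.jacBeta ((M.θ n).1, b) i j) (fun b => C b i j) atTop N
  rank : (C M.θlim.2).rank = q

/-- Weak sequences, with limit function `c` and `B(S)` as set of `β`. -/
def Weak (S : Set (Vec (Fin p))) (c : Vec (Fin q) → Vec (Fin r)) : Prop :=
  TendstoUniformlyOn (fun (n : ℕ) b => √n • (M.τ ((M.θ n).1, b) - M.τ (M.θ n))) c atTop
    (M.crossSection S)

/-- The remainder `R_n(d)` of the quadratic expansion of `T_n` around `δ_n = δ(θ_n)`. -/
def remainder (T : ∀ n, Ω n → Vec (Fin p ⊕ Fin r) → ℝ) (n : ℕ) (ω : Ω n)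
    (d : Vec (Fin p ⊕ Fin r)) : ℝ :=
  T n ω d - T n ω (M.δ (M.θ n))
    - (gradient (T n ω) (M.δ (M.θ n))).ofLp ⬝ᵥ (d - M.δ (M.θ n)).ofLp
    - 1 / 2 * ((d - M.δ (M.θ n)).ofLp ⬝ᵥ
        (hessian (T n ω) (M.δ (M.θ n)) *ᵥ (d - M.δ (M.θ n)).ofLp))

/-- The remainder of the quadratic expansion is negligible. -/
def QuadraticExpansion (T : ∀ n, Ω n → Vec (Fin p ⊕ Fin r) → ℝ) : Prop :=
  ∀ η : ℕ → ℝ, (∀ n, 0 < η n) → Tendsto η atTop (𝓝 0) →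
    NegligibleInProb M.P fun n ω =>
      ⨆ d ∈ M.reduced, ⨆ _ : ‖d - M.δ (M.θ n)‖ ≤ η n,
        ENNReal.ofReal (|n * M.remainder T n ω d| / (1 + √n * ‖d - M.δ (M.θ n)‖) ^ 2)

/-- The reduced-form objective function is locally asymptotically normal at `δ_n`:
`√n ∂T_n(δ_n) → Y ~ N(0, V)` in distribution and `∂²T_n(δ_n) → H` in probability. -/
structure ReducedFormLimits (T : ∀ n, Ω n → Vec (Fin p ⊕ Fin r) → ℝ)
    {Ω' : Type*} [MeasurableSpace Ω'] (P' : Measure Ω') [IsProbabilityMeasure P']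
    (Y : Ω' → Vec (Fin p ⊕ Fin r)) (V H : Matrix (Fin p ⊕ Fin r) (Fin p ⊕ Fin r) ℝ) : Prop where
  posDef_V : V.PosDef
  law_Y : HasLaw Y (multivariateGaussian 0 V) P'
  score : TendstoInDistribution (fun (n : ℕ) ω => √n • gradient (T n ω) (M.δ (M.θ n))) atTop Y
    M.P P'
  posDef_H : H.PosDef
  hess : ∀ i j, NegligibleInProb M.P fun n ω =>
    ENNReal.ofReal |hessian (T n ω) (M.δ (M.θ n)) i j - H i j|

/-- The pair `(√n (π - π_n), √n (β - β_n) / a_n)`. -/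
def rescale (a : ℕ → ℝ) (n : ℕ) (x : Param p q) : Param p q :=
  (√n • (x.1 - (M.θ n).1), (√n / a n) • (x.2 - (M.θ n).2))

/-- The local parameter space. -/
def localSpace (a : ℕ → ℝ) (n : ℕ) : Set (Param p q) := M.rescale a n '' M.space

/-- `Ψ` is closed and convex, and it is the Kuratowski limit of the local parameter spaces. -/
structure LocalLimit (a : ℕ → ℝ) (Ψ : Set (Param p q)) : Prop where
  isClosed : IsClosed Ψ
  limit : KuratowskiTendsto (M.localSpace a) Ψ
  convex : Convex ℝ Ψ

/-- `D_*`, with lower right block `C`. -/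
def Dstar (C : Matrix (Fin r) (Fin q) ℝ) : Matrix (Fin p ⊕ Fin r) (Fin p ⊕ Fin q) ℝ :=
  Matrix.fromBlocks 1 0 (M.jacPi M.θlim) C

/-- `J = D_*' H D_*`. -/
def J (H : Matrix (Fin p ⊕ Fin r) (Fin p ⊕ Fin r) ℝ) (C : Matrix (Fin r) (Fin q) ℝ) :
    Matrix (Fin p ⊕ Fin q) (Fin p ⊕ Fin q) ℝ :=
  (M.Dstar C)ᵀ * H * M.Dstar C

/-- `Z = -J⁻¹ D_*' Y`, at the value `y` of `Y`. -/
def Z (H : Matrix (Fin p ⊕ Fin r) (Fin p ⊕ Fin r) ℝ) (C : Matrix (Fin r) (Fin q) ℝ)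
    (y : Vec (Fin p ⊕ Fin r)) : Fin p ⊕ Fin q → ℝ :=
  -((M.J H C)⁻¹ *ᵥ ((M.Dstar C)ᵀ *ᵥ y.ofLp))

/-- `q^S(ψ) = (Z - ψ)' J (Z - ψ) / 2 - Z' J Z / 2`. -/
def qS (H : Matrix (Fin p ⊕ Fin r) (Fin p ⊕ Fin r) ℝ) (C : Matrix (Fin r) (Fin q) ℝ)
    (y : Vec (Fin p ⊕ Fin r)) (ψ : Param p q) : ℝ :=
  ((M.Z H C y - col ψ) ⬝ᵥ (M.J H C *ᵥ (M.Z H C y - col ψ))) / 2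
    - (M.Z H C y ⬝ᵥ (M.J H C *ᵥ M.Z H C y)) / 2

/-- `D_1(π_*, β)`. -/
def D1 (b : Vec (Fin q)) : Matrix (Fin p ⊕ Fin r) (Fin p) ℝ :=
  Matrix.fromRows 1 (M.jacPi (M.θlim.1, b))

/-- `J_11(β) = D_1(π_*, β)' H D_1(π_*, β)`. -/
def J11 (H : Matrix (Fin p ⊕ Fin r) (Fin p ⊕ Fin r) ℝ) (b : Vec (Fin q)) :
    Matrix (Fin p) (Fin p) ℝ :=
  (M.D1 b)ᵀ * H * M.D1 b

/-- `g(β) = (0, c(β))`. -/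
def gvec (c : Vec (Fin q) → Vec (Fin r)) (b : Vec (Fin q)) : Fin p ⊕ Fin r → ℝ :=
  Sum.elim 0 (c b).ofLp

/-- `Z_1(β) = -J_11(β)⁻¹ D_1(π_*, β)' (Y + H g(β))`, at the value `y` of `Y`. -/
def Z1 (H : Matrix (Fin p ⊕ Fin r) (Fin p ⊕ Fin r) ℝ) (c : Vec (Fin q) → Vec (Fin r))
    (y : Vec (Fin p ⊕ Fin r)) (b : Vec (Fin q)) : Vec (Fin p) :=
  WithLp.toLp 2 (-((M.J11 H b)⁻¹ *ᵥ ((M.D1 b)ᵀ *ᵥ (y.ofLp + H *ᵥ gvec c b))))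

/-- `q̃^W(β) = g(β)' H g(β) / 2 + Y' g(β) - Z_1(β)' J_11(β) Z_1(β) / 2`. -/
def qtW (H : Matrix (Fin p ⊕ Fin r) (Fin p ⊕ Fin r) ℝ) (c : Vec (Fin q) → Vec (Fin r))
    (y : Vec (Fin p ⊕ Fin r)) (b : Vec (Fin q)) : ℝ :=
  (gvec c b ⬝ᵥ (H *ᵥ gvec c b)) / 2 + y.ofLp ⬝ᵥ gvec c b
    - ((M.Z1 H c y b).ofLp ⬝ᵥ (M.J11 H b *ᵥ (M.Z1 H c y b).ofLp)) / 2

/-- `q^W(ψ₁, β) = (Z_1(β) - ψ₁)' J_11(β) (Z_1(β) - ψ₁) / 2 + q̃^W(β)`. -/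
def qW (H : Matrix (Fin p ⊕ Fin r) (Fin p ⊕ Fin r) ℝ) (c : Vec (Fin q) → Vec (Fin r))
    (y : Vec (Fin p ⊕ Fin r)) (x : Param p q) : ℝ :=
  ((M.Z1 H c y x.2 - x.1).ofLp ⬝ᵥ (M.J11 H x.2 *ᵥ (M.Z1 H c y x.2 - x.1).ofLp)) / 2
    + M.qtW H c y x.2

end Model

end MinDist

end

/-!
The proof replaces subsequence arguments by filters on the disjoint union `Σ n, Ω n` of the sample
spaces. The events whose (inner) probability tends to one form a filter `probFilter`, and an
`o_p(1)` is a function that tends to zero along it. Restricting this filter further to events on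
which the rescaled score `√n ∂T_n(δ_n)` is close to a fixed vector `y` turns M-estimation into a
deterministic problem: it is enough that, along the restricted filter, the rescaled estimator
converges to the minimizer of the limit criterion at `Y = y`. The passage back to convergence in
distribution is an extended continuous mapping theorem, `tendstoInDistribution_of_tendsto`, which
follows from the portmanteau theorem and a Lindelöf argument, and also gives the measurability of
the limit.

The deterministic problem is solved as follows. For random parameters `x` with
`δ(x) - δ_n → 0`, the criterion `n (Q_n(x) - T_n(δ_n))` is a quadratic function of
`s = √n (δ(x) - δ_n)` up to `o(1) (1 + ‖s‖)²` (`tendsto_expansion`). The reduced-form parameter is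
consistent (`tendsto_δ_estim`), and positive definiteness of `H` bounds `s` at the estimator
(`exists_norm_dev_estim_le`). In the strong and semi-strong regimes this gives consistency of
the structural parameter; then `s` is `D_* ψ` up to a negligible error, `ψ` being the local
parameter (`isLittleO_dev`), and since `D_*` is injective, `ψ` is bounded. In the weak regime `s` is
asymptotically `D_1(β) ψ₁ + g(β)`, and `β` ranges over a compact set. In both cases every limit
point of the estimator along an ultrafilter is compared with the minimizer of the limit criterion,
which is a limit of parameters in `Θ`, by Kuratowski convergence or by the Lipschitz property of the
cross-sections (`quad_le_quad`). Completing the square identifies the limit criteria with `q^S`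
and `q^W` (`qS_eq`, `qW_eq`), and uniqueness of the minimizer finishes the proof.
-/

noncomputable section

namespace MinDist

open Asymptotics

/-! ### Convergence in probability and in distribution -/

section Probability

variable {Ω : ℕ → Type*} [∀ n, MeasurableSpace (Ω n)]

/-- The filter of events in the disjoint union of the sample spaces whose probability tends to
one. Convergence in probability on varying spaces is `Tendsto` along this filter. For sets that are
not measurable, it is the outer probability of the complement that has to vanish. -/
def probFilter (P : ∀ n, Measure (Ω n)) : Filter (Σ n, Ω n) where
  sets := {A | Tendsto (fun n => P n {ω | (⟨n, ω⟩ : Σ n, Ω n) ∉ A}) atTop (𝓝 0)}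
  univ_sets := by simp
  sets_of_superset {A B} hA hAB :=
    tendsto_of_tendsto_of_tendsto_of_le_of_le tendsto_const_nhds hA (fun _ => zero_le)
      fun n => measure_mono fun ω hω h => hω (hAB h)
  inter_sets {A B} hA hB := by
    have hAB := Tendsto.add (Set.mem_ofPred.1 hA) (Set.mem_ofPred.1 hB)
    rw [add_zero] at hAB
    refine tendsto_of_tendsto_of_tendsto_of_le_of_le tendsto_const_nhds hAB
      (fun _ => zero_le) fun n => ?_
    refine le_trans (measure_mono fun ω hω => ?_) (measure_union_le _ _)
    by_contra hc
    simp only [Set.mem_union, Set.mem_ofPred_eq, not_or, not_not] at hc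
    exact hω hc

variable {P : ∀ n, Measure (Ω n)}

lemma mem_probFilter {A : Set (Σ n, Ω n)} : A ∈ probFilter P ↔
    Tendsto (fun n => P n {ω | (⟨n, ω⟩ : Σ n, Ω n) ∉ A}) atTop (𝓝 0) := Iff.rfl

lemma tendsto_fst_probFilter : Tendsto (Sigma.fst : (Σ n, Ω n) → ℕ) (probFilter P) atTop := by
  refine tendsto_atTop.2 fun N => ?_
  refine mem_probFilter.2 (tendsto_const_nhds.congr' ?_)
  filter_upwards [eventually_ge_atTop N] with n hn
  simp [hn]

lemma NegligibleInProb.tendsto {X : ∀ n, Ω n → ℝ≥0∞} (h : NegligibleInProb P X) :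
    Tendsto (fun w : Σ n, Ω n => X w.1 w.2) (probFilter P) (𝓝 0) := by
  refine ENNReal.tendsto_nhds_zero.2 fun ε hε => ?_
  refine mem_probFilter.2 (tendsto_of_tendsto_of_tendsto_of_le_of_le tendsto_const_nhds
    (h ε hε) (fun _ => zero_le) fun n => measure_mono fun ω hω => ?_)
  simp only [Set.mem_ofPred_eq, not_le] at hω ⊢
  exact hω.le

/-- A deterministic rate for convergence to zero in probability. It turns the hypotheses on
shrinking deterministic neighborhoods into statements about random points. -/
lemma exists_rate [∀ n, IsProbabilityMeasure (P n)] {X : (Σ n, Ω n) → ℝ}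
    (h : Tendsto X (probFilter P) (𝓝 0)) :
    ∃ η : ℕ → ℝ, (∀ n, 0 < η n) ∧ Tendsto η atTop (𝓝 0) ∧
      ∀ᶠ w in probFilter P, X w ≤ η w.1 := by
  -- up to `1 / (n + 1)`, the rate is the Ky Fan distance of `X` to zero
  let S : ℕ → Set ℝ := fun n => {x | 0 ≤ x ∧ P n {ω | ¬ X ⟨n, ω⟩ ≤ x} ≤ ENNReal.ofReal x}
  have hne : ∀ n, (S n).Nonempty := fun n => ⟨1, zero_le_one, by simpa using prob_le_one⟩
  have hbd : ∀ n, BddBelow (S n) := fun n => ⟨0, fun x hx => hx.1⟩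
  have hnn : ∀ n, 0 ≤ sInf (S n) := fun n => le_csInf (hne n) fun x hx => hx.1
  have hpos : ∀ n : ℕ, (0 : ℝ) < 1 / (n + 1) := fun n => Nat.one_div_pos_of_nat
  have hη : Tendsto (fun n : ℕ => sInf (S n) + 1 / ((n : ℝ) + 1)) atTop (𝓝 0) := by
    suffices hS : Tendsto (fun n : ℕ => sInf (S n)) atTop (𝓝 0) by
      simpa using hS.add tendsto_one_div_add_atTop_nhds_zero_nat
    rw [Metric.tendsto_atTop']
    intro ε hε
    have h1 : ∀ᶠ w in probFilter P, X w ≤ ε / 2 :=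
      (h.eventually (gt_mem_nhds (half_pos hε))).mono fun w hw => hw.le
    have h2 := ENNReal.tendsto_nhds_zero.1 (mem_probFilter.1 h1) (ENNReal.ofReal (ε / 2))
      (ENNReal.ofReal_pos.2 (half_pos hε))
    obtain ⟨N, hN⟩ := eventually_atTop.1 h2
    refine ⟨N, fun n hn => ?_⟩
    rw [Real.dist_0_eq_abs, abs_of_nonneg (hnn n)]
    exact lt_of_le_of_lt (csInf_le (hbd n) ⟨(half_pos hε).le, hN n hn.le⟩) (half_lt_self hε)
  refine ⟨fun n => sInf (S n) + 1 / ((n : ℝ) + 1), fun n => add_pos_of_nonneg_of_pos (hnn n)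
    (hpos n), hη, ?_⟩
  refine mem_probFilter.2 ?_
  have h0 : Tendsto (fun n : ℕ => ENNReal.ofReal (sInf (S n) + 1 / ((n : ℝ) + 1))) atTop (𝓝 0) := by
    simpa using ENNReal.tendsto_ofReal hη
  refine tendsto_of_tendsto_of_tendsto_of_le_of_le tendsto_const_nhds h0
    (fun _ => zero_le) fun n => ?_
  obtain ⟨x, hx, hxlt⟩ := exists_lt_of_csInf_lt (hne n) (lt_add_of_pos_right _ (hpos n))
  exact le_trans (measure_mono fun ω hω (h' : X ⟨n, ω⟩ ≤ x) => hω (h'.trans hxlt.le))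
    (hx.2.trans (ENNReal.ofReal_le_ofReal hxlt.le))

lemma aemeasurable_comp_of_continuousOn {Ω' E F : Type*} [MeasurableSpace Ω'] {μ : Measure Ω'}
    [TopologicalSpace E] [MeasurableSpace E] [OpensMeasurableSpace E]
    [TopologicalSpace F] [MeasurableSpace F] [BorelSpace F]
    {Y : Ω' → E} (hY : AEMeasurable Y μ) {h : E → F} {G : Set E} (hG : ∀ᵐ ω ∂μ, Y ω ∈ G)
    (hc : ContinuousOn h G) : AEMeasurable (fun ω => h (Y ω)) μ := by
  obtain ⟨Y', hY', hYY'⟩ := hY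
  have hN : ∀ᵐ ω ∂μ, Y ω ∈ G ∧ Y ω = Y' ω := hG.and hYY'
  obtain ⟨t, ht, htm, htae⟩ := exists_measurable_superset_of_null (mem_ae_iff.1 hN)
  have htc : ∀ᵐ ω ∂μ, ω ∈ tᶜ := by rw [ae_iff]; simpa using htae
  rw [← Measure.restrict_eq_self_of_ae_mem htc]
  refine aemeasurable_restrict_of_measurable_subtype htm.compl ?_
  have hmem : ∀ ω : (tᶜ : Set Ω'), Y ω ∈ G ∧ Y ω = Y' ω := fun ω => by
    by_contra hc
    exact ω.2 (ht hc)
  have h1 : Measurable fun ω : (tᶜ : Set Ω') => (⟨Y ω, (hmem ω).1⟩ : G) := by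
    refine Measurable.subtype_mk ?_
    have : (fun ω : (tᶜ : Set Ω') => Y ω) = fun ω : (tᶜ : Set Ω') => Y' ω :=
      funext fun ω => (hmem ω).2
    rw [this]
    exact hY'.comp measurable_subtype_coe
  exact (continuousOn_iff_continuous_domRestrict.1 hc).measurable.comp h1

variable {Ω' : Type*} [MeasurableSpace Ω'] {P' : Measure Ω'} [IsProbabilityMeasure P']
  [∀ n, IsProbabilityMeasure (P n)]
  {E F : Type*} [TopologicalSpace E] [MeasurableSpace E] [BorelSpace E]
  [HasOuterApproxClosed E]
  [TopologicalSpace F] [MeasurableSpace F] [BorelSpace F]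
  {Yn : ∀ n, Ω n → E} {Y : Ω' → E}

lemma le_liminf_of_tendstoInDistribution (hY : TendstoInDistribution Yn atTop Y P P')
    {O : Set E} (hO : IsOpen O) :
    P' {ω | Y ω ∈ O} ≤ liminf (fun n => P n {ω | Yn n ω ∈ O}) atTop := by
  have := ProbabilityMeasure.le_liminf_measure_open_of_tendsto hY.tendsto hO
  simp only [ProbabilityMeasure.coe_mk] at this
  rw [Measure.map_apply_of_aemeasurable hY.aemeasurable_limit hO.measurableSet] at this
  refine this.trans (le_of_eq ?_)
  congr 1
  ext n
  rw [Measure.map_apply_of_aemeasurable (hY.forall_aemeasurable n) hO.measurableSet]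
  rfl

/-- A limit in distribution `Y` has almost surely values `y` to which the `Yn` come near with
probability bounded away from zero. -/
lemma ae_neBot_probFilter [SecondCountableTopology E]
    (hY : TendstoInDistribution Yn atTop Y P P') :
    ∀ᵐ ω ∂P', (probFilter P ⊓ comap (fun w : Σ n, Ω n => Yn w.1 w.2) (𝓝 (Y ω))).NeBot := by
  have h1 : ∀ᵐ y ∂(P'.map Y), y ∈ (P'.map Y).support := Measure.support_mem_ae
  filter_upwards [ae_of_ae_map hY.aemeasurable_limit h1] with ω hω
  refine ((𝓝 (Y ω)).basis_sets.comap _ |>.inf_basis_neBot_iff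
    (probFilter P).basis_sets |>.2 ?_ : _) |> fun h => inf_comm (probFilter P) _ ▸ h
  intro O hO A hA
  obtain ⟨O', hO'O, hO', hyO'⟩ := mem_nhds_iff.1 hO
  by_contra hempty
  have hpos : 0 < P' {ω | Y ω ∈ O'} := by
    have := (Measure.mem_support_iff_forall _).1 hω O' (hO'.mem_nhds hyO')
    rwa [Measure.map_apply_of_aemeasurable hY.aemeasurable_limit hO'.measurableSet] at this
  have h0 : liminf (fun n => P n {ω | Yn n ω ∈ O'}) atTop = 0 := by
    refine Tendsto.liminf_eq ?_
    refine tendsto_of_tendsto_of_tendsto_of_le_of_le tendsto_const_nhds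
      (mem_probFilter.1 hA) (fun _ => zero_le) fun n => measure_mono fun ω' hω' hA' => ?_
    exact hempty ⟨⟨n, ω'⟩, hO'O hω', hA'⟩
  have := le_liminf_of_tendstoInDistribution hY hO'
  rw [h0] at this
  exact absurd hpos (not_lt.2 this)

/-- An extended continuous mapping theorem. Suppose that `Yn` converges in distribution to `Y` and
that, for almost every value `y` of `Y`, the variables `X n` are near `h y` whenever
`Yn` is near `y`, up to events of vanishing probability. Then `X` converges in distribution to
`h ∘ Y`. The function `h` need not be measurable. -/
theorem tendstoInDistribution_of_tendsto [SecondCountableTopology E] [HasOuterApproxClosed F]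
    [RegularSpace F]
    (hY : TendstoInDistribution Yn atTop Y P P')
    {X : ∀ n, Ω n → F} (hX : ∀ n, AEMeasurable (X n) (P n)) {h : E → F}
    (hh : ∀ᵐ ω ∂P', Tendsto (fun w : Σ n, Ω n => X w.1 w.2)
      (probFilter P ⊓ comap (fun w : Σ n, Ω n => Yn w.1 w.2) (𝓝 (Y ω))) (𝓝 (h (Y ω)))) :
    TendstoInDistribution X atTop (fun ω => h (Y ω)) P P' := by
  set fil : E → Filter (Σ n, Ω n) := fun y =>
    probFilter P ⊓ comap (fun w : Σ n, Ω n => Yn w.1 w.2) (𝓝 y) with hfil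
  -- membership in `fil y`, spelled out
  have hmem : ∀ y (B : Set (Σ n, Ω n)), B ∈ fil y ↔ ∃ A ∈ probFilter P, ∃ O : Set E, IsOpen O ∧
      y ∈ O ∧ ∀ w ∈ A, Yn w.1 w.2 ∈ O → w ∈ B := by
    intro y B
    rw [hfil, mem_inf_iff_superset]
    constructor
    · rintro ⟨A, hA, C, hC, hAC⟩
      obtain ⟨O, hO, hOC⟩ := mem_comap.1 hC
      obtain ⟨O', hO'O, hO', hyO'⟩ := mem_nhds_iff.1 hO
      exact ⟨A, hA, O', hO', hyO', fun w hw hwO => hAC ⟨hw, hOC (hO'O hwO)⟩⟩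
    · rintro ⟨A, hA, O, hO, hyO, hAO⟩
      exact ⟨A, hA, _, preimage_mem_comap (hO.mem_nhds hyO), fun w hw => hAO w hw.1 hw.2⟩
  have hmeas : AEMeasurable (fun ω => h (Y ω)) P' := by
    refine aemeasurable_comp_of_continuousOn hY.aemeasurable_limit
      (G := {y | (fil y).NeBot ∧ Tendsto (fun w : Σ n, Ω n => X w.1 w.2) (fil y) (𝓝 (h y))})
      ((ae_neBot_probFilter hY).and hh) fun y hy => ?_
    refine (closed_nhds_basis (h y)).tendsto_right_iff.2 fun C hC => ?_
    obtain ⟨A, hA, O, hO, hyO, hAO⟩ := (hmem y _).1 (hy.2 hC.1)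
    filter_upwards [self_mem_nhdsWithin, mem_nhdsWithin_of_mem_nhds (hO.mem_nhds hyO)]
      with y' hy' hy'O
    have := hy'.1
    exact hC.2.mem_of_tendsto hy'.2 ((hmem y' _).2 ⟨A, hA, O, hO, hy'O, hAO⟩)
  refine ⟨hX, hmeas, tendsto_of_forall_isOpen_le_liminf' fun U hU => ?_⟩
  simp only [ProbabilityMeasure.coe_mk]
  rw [Measure.map_apply_of_aemeasurable hmeas hU.measurableSet]
  have hXU : (fun n => ((P n).map (X n)) U) = fun n => P n {ω | X n ω ∈ U} := by
    ext n
    rw [Measure.map_apply_of_aemeasurable (hX n) hU.measurableSet]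
    rfl
  rw [hXU]
  -- the open sets on which nearness of `Yn` forces `X n` into `U`
  let 𝒪 : Set (Set E) := {O | IsOpen O ∧ ∃ A ∈ probFilter P,
    ∀ w ∈ A, Yn w.1 w.2 ∈ O → X w.1 w.2 ∈ U}
  have hempty : ∅ ∈ 𝒪 := ⟨isOpen_empty, Set.univ, univ_mem, fun w _ hw => hw.elim⟩
  have hunion : ∀ O₁ ∈ 𝒪, ∀ O₂ ∈ 𝒪, O₁ ∪ O₂ ∈ 𝒪 := by
    rintro O₁ ⟨h1, A₁, hA₁, h1'⟩ O₂ ⟨h2, A₂, hA₂, h2'⟩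
    exact ⟨h1.union h2, A₁ ∩ A₂, inter_mem hA₁ hA₂,
      fun w hw hwO => hwO.elim (h1' w hw.1) (h2' w hw.2)⟩
  have hbound : ∀ O ∈ 𝒪, P' {ω | Y ω ∈ O} ≤ liminf (fun n => P n {ω | X n ω ∈ U}) atTop := by
    rintro O ⟨hO, A, hA, hAO⟩
    refine (le_liminf_of_tendstoInDistribution hY hO).trans ?_
    have h1 : ∀ n, P n {ω | Yn n ω ∈ O} ≤
        P n {ω | X n ω ∈ U} + P n {ω | (⟨n, ω⟩ : Σ n, Ω n) ∉ A} := fun n => by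
      refine le_trans (measure_mono fun ω hω => ?_) (measure_union_le _ _)
      by_cases hwA : (⟨n, ω⟩ : Σ n, Ω n) ∈ A
      · exact Or.inl (hAO _ hwA hω)
      · exact Or.inr hwA
    refine ENNReal.le_of_forall_pos_le_add fun ε hε _ => ?_
    have hev := ENNReal.tendsto_nhds_zero.1 (mem_probFilter.1 hA) (ε : ℝ≥0∞) (by simpa using hε)
    calc liminf (fun n => P n {ω | Yn n ω ∈ O}) atTop
        ≤ liminf (fun n => P n {ω | X n ω ∈ U} + ε) atTop :=
          liminf_le_liminf (hev.mono fun n hn => (h1 n).trans (by gcongr))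
      _ ≤ liminf (fun n => P n {ω | X n ω ∈ U}) atTop + ε := by
          refine le_of_eq ?_
          exact (Monotone.map_liminf_of_continuousAt (F := atTop)
            (f := fun x : ℝ≥0∞ => x + ε) (fun a b hab => add_le_add_left hab _)
            (fun n => P n {ω | X n ω ∈ U}) (by fun_prop)).symm
  obtain ⟨T, hTc, hT𝒪, hTU⟩ := TopologicalSpace.isOpen_sUnion_countable 𝒪 fun O hO => hO.1
  obtain ⟨f, hf⟩ := (hTc.insert ∅).exists_eq_range (Set.insert_nonempty _ _)
  have hf𝒪 : ∀ k, f k ∈ 𝒪 := fun k => by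
    have : f k ∈ insert ∅ T := hf ▸ Set.mem_range_self k
    rcases this with h' | h'
    · exact h' ▸ hempty
    · exact hT𝒪 h'
  have hacc : ∀ k, Set.accumulate f k ∈ 𝒪 := fun k => by
    induction k with
    | zero => simpa [Set.accumulate_zero_nat] using hf𝒪 0
    | succ k ih => rw [Set.accumulate_succ]; exact hunion _ ih _ (hf𝒪 _)
  calc P' ((fun ω => h (Y ω)) ⁻¹' U) ≤ P' (⋃ k, Y ⁻¹' f k) := by
        refine measure_mono_ae ?_
        filter_upwards [hh] with ω hω hωU
        obtain ⟨A, hA, O, hO, hyO, hAO⟩ := (hmem (Y ω) _).1 (hω (hU.mem_nhds hωU))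
        have h1 : Y ω ∈ ⋃₀ T := hTU ▸ ⟨O, ⟨hO, A, hA, hAO⟩, hyO⟩
        obtain ⟨O', hO', hyO'⟩ := h1
        have h2 : O' ∈ Set.range f := hf ▸ Or.inr hO'
        obtain ⟨k, rfl⟩ := h2
        exact Set.mem_iUnion.2 ⟨k, hyO'⟩
    _ = ⨆ k, P' (Set.accumulate (fun k => Y ⁻¹' f k) k) := measure_iUnion_eq_iSup_accumulate
    _ ≤ _ := iSup_le fun k => by
        refine le_trans (le_of_eq ?_) (hbound _ (hacc k))
        congr 1
        ext ω
        simp [Set.mem_accumulate]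

end Probability

/-! ### Quadratic expansion and rate of the reduced-form parameters -/

/-- The quadratic function `s ↦ y's + s'Hs/2`. -/
def quad {ι : Type*} [Fintype ι] (H : Matrix ι ι ℝ) (y s : Vec ι) : ℝ :=
  y.ofLp ⬝ᵥ s.ofLp + 1 / 2 * (s.ofLp ⬝ᵥ (H *ᵥ s.ofLp))

section Quad

variable {ι : Type*} [Fintype ι]

lemma continuous_quad (H : Matrix ι ι ℝ) : Continuous fun z : Vec ι × Vec ι => quad H z.1 z.2 := by
  unfold quad
  simp only [dotProduct, mulVec]
  fun_prop

lemma abs_dotProduct_le (y s : Vec ι) : |y.ofLp ⬝ᵥ s.ofLp| ≤ ‖y‖ * ‖s‖ := by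
  have h : y.ofLp ⬝ᵥ s.ofLp = inner ℝ s y := by
    rw [EuclideanSpace.inner_eq_star_dotProduct]; simp
  rw [h, mul_comm]
  exact abs_real_inner_le_norm s y

lemma abs_quad_sub_quad_le (H H' : Matrix ι ι ℝ) (y s : Vec ι) :
    |quad H y s - quad H' y s| ≤ (∑ i, ∑ j, |H i j - H' i j|) * ‖s‖ ^ 2 := by
  have h : quad H y s - quad H' y s
      = 1 / 2 * ∑ i, ∑ j, s.ofLp i * ((H i j - H' i j) * s.ofLp j) := by
    have : s.ofLp ⬝ᵥ (H *ᵥ s.ofLp) - s.ofLp ⬝ᵥ (H' *ᵥ s.ofLp)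
        = s.ofLp ⬝ᵥ ((H - H') *ᵥ s.ofLp) := by
      rw [sub_mulVec, dotProduct_sub]
    have h2 : s.ofLp ⬝ᵥ ((H - H') *ᵥ s.ofLp)
        = ∑ i, ∑ j, s.ofLp i * ((H i j - H' i j) * s.ofLp j) := by
      simp [dotProduct, mulVec, Finset.mul_sum]
    unfold quad
    linarith
  have hs : ∀ i, |s.ofLp i| ≤ ‖s‖ := fun i => by simpa using PiLp.norm_apply_le s i
  rw [h, abs_mul, Finset.sum_mul]
  have h1 : |∑ i, ∑ j, s.ofLp i * ((H i j - H' i j) * s.ofLp j)|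
      ≤ ∑ i, (∑ j, |H i j - H' i j|) * ‖s‖ ^ 2 := by
    refine (Finset.abs_sum_le_sum_abs _ _).trans (Finset.sum_le_sum fun i _ => ?_)
    rw [Finset.sum_mul]
    refine (Finset.abs_sum_le_sum_abs _ _).trans (Finset.sum_le_sum fun j _ => ?_)
    rw [abs_mul, abs_mul]
    calc |s.ofLp i| * (|H i j - H' i j| * |s.ofLp j|)
        = |H i j - H' i j| * (|s.ofLp i| * |s.ofLp j|) := by ring
      _ ≤ |H i j - H' i j| * (‖s‖ * ‖s‖) := by gcongr <;> exact hs _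
      _ = _ := by ring
  have h0 : 0 ≤ |∑ i, ∑ j, s.ofLp i * ((H i j - H' i j) * s.ofLp j)| := abs_nonneg _
  rw [abs_of_pos (by norm_num : (0 : ℝ) < 1 / 2)]
  linarith

/-- A positive definite quadratic form dominates the square of the norm. -/
lemma exists_pos_mul_sq_le {H : Matrix ι ι ℝ} (hH : H.PosDef) :
    ∃ c > 0, ∀ s : Vec ι, c * ‖s‖ ^ 2 ≤ s.ofLp ⬝ᵥ (H *ᵥ s.ofLp) := by
  have hcont : Continuous fun s : Vec ι => s.ofLp ⬝ᵥ (H *ᵥ s.ofLp) := by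
    simp only [dotProduct, mulVec]
    fun_prop
  have hpos : ∀ s : Vec ι, s ≠ 0 → 0 < s.ofLp ⬝ᵥ (H *ᵥ s.ofLp) := fun s hs => by
    have h0 : s.ofLp ≠ 0 := fun h => hs (by ext i; exact congrFun h i)
    simpa using hH.dotProduct_mulVec_pos h0
  rcases (Metric.sphere (0 : Vec ι) 1).eq_empty_or_nonempty with he | hne
  · refine ⟨1, one_pos, fun s => ?_⟩
    have : s = 0 := by
      by_contra hs
      have : ‖s‖⁻¹ • s ∈ Metric.sphere (0 : Vec ι) 1 := by
        simp [norm_smul, inv_mul_cancel₀ (norm_ne_zero_iff.2 hs)]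
      rw [he] at this
      exact this
    simp [this]
  · obtain ⟨u, hu, hmin⟩ := (isCompact_sphere (0 : Vec ι) 1).exists_isMinOn hne hcont.continuousOn
    refine ⟨_, hpos u (by rintro rfl; simp at hu), fun s => ?_⟩
    rcases eq_or_ne s 0 with rfl | hs
    · simp
    have hs' : ‖s‖ ≠ 0 := norm_ne_zero_iff.2 hs
    have hmem : ‖s‖⁻¹ • s ∈ Metric.sphere (0 : Vec ι) 1 := by
      simp [norm_smul, inv_mul_cancel₀ hs']
    have h1 := isMinOn_iff.1 hmin _ hmem
    simp only [WithLp.ofLp_smul, mulVec_smul, dotProduct_smul, smul_dotProduct, smul_eq_mul] at h1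
    have h2 : ‖s‖⁻¹ * (‖s‖⁻¹ * (s.ofLp ⬝ᵥ (H *ᵥ s.ofLp))) * ‖s‖ ^ 2
        = s.ofLp ⬝ᵥ (H *ᵥ s.ofLp) := by field_simp
    calc _ ≤ _ := mul_le_mul_of_nonneg_right h1 (sq_nonneg ‖s‖)
      _ = _ := h2

end Quad

namespace Model

variable {p q r : ℕ} {Ω : ℕ → Type*} [∀ n, MeasurableSpace (Ω n)] (M : Model p q r Ω)
  {T : ∀ n, Ω n → Vec (Fin p ⊕ Fin r) → ℝ}

/-- The rescaled deviation `√n (δ(x) - δ_n)` of the reduced-form parameter. -/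
def dev (n : ℕ) (x : Param p q) : Vec (Fin p ⊕ Fin r) := √n • (M.δ x - M.δ (M.θ n))

/-- The rescaled score `√n ∂T_n(δ_n)`. -/
def score (T : ∀ n, Ω n → Vec (Fin p ⊕ Fin r) → ℝ) (w : Σ n, Ω n) : Vec (Fin p ⊕ Fin r) :=
  √w.1 • gradient (T w.1 w.2) (M.δ (M.θ w.1))

/-- The estimator, as a function on the disjoint union of the sample spaces. -/
def estim (w : Σ n, Ω n) : Param p q := M.est w.1 w.2

/-- The rescaled objective function `n (Q_n(x) - T_n(δ_n))`, centered at the reduced-form true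
value. -/
def obj (T : ∀ n, Ω n → Vec (Fin p ⊕ Fin r) → ℝ) (w : Σ n, Ω n) (x : Param p q) : ℝ :=
  w.1 * (M.Q w.1 w.2 x - T w.1 w.2 (M.δ (M.θ w.1)))

variable {M}

lemma norm_dev (n : ℕ) (x : Param p q) :
    ‖M.dev n x‖ = √n * ‖M.δ x - M.δ (M.θ n)‖ := by
  rw [dev, norm_smul, Real.norm_of_nonneg (Real.sqrt_nonneg _)]

lemma tendsto_of_tendsto_ofReal_abs {α : Type*} {l : Filter α} {f : α → ℝ}
    (h : Tendsto (fun a => ENNReal.ofReal |f a|) l (𝓝 0)) : Tendsto f l (𝓝 0) := by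
  rw [tendsto_zero_iff_abs_tendsto_zero]
  have := (ENNReal.tendsto_toReal ENNReal.zero_ne_top).comp h
  simpa [Function.comp_def, ENNReal.toReal_ofReal (abs_nonneg _)] using this

lemma Framework.mem_big (hM : M.Framework) {x : Param p q} (hx : x ∈ M.space) : x ∈ M.big :=
  hM.space_subset hx

lemma mul_sub_reduced_eq (T : ∀ n, Ω n → Vec (Fin p ⊕ Fin r) → ℝ) (w : Σ n, Ω n)
    (x : Param p q) :
    w.1 * (T w.1 w.2 (M.δ x) - T w.1 w.2 (M.δ (M.θ w.1)))
      = w.1 * M.remainder T w.1 w.2 (M.δ x)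
        + quad (hessian (T w.1 w.2) (M.δ (M.θ w.1))) (M.score T w) (M.dev w.1 x) := by
  have hn : (w.1 : ℝ) = √w.1 * √w.1 := (Real.mul_self_sqrt (Nat.cast_nonneg _)).symm
  simp only [remainder, quad, score, dev, WithLp.ofLp_smul, mulVec_smul, dotProduct_smul,
    smul_dotProduct, smul_eq_mul]
  generalize √(w.1 : ℝ) = u at *
  rw [hn]
  ring

/-- The quadratic expansion of the objective function at random points that approach `δ_n`. -/
lemma tendsto_expansion (hobj : M.ReducedFormObjective T) (hquad : M.QuadraticExpansion T)
    {H : Matrix (Fin p ⊕ Fin r) (Fin p ⊕ Fin r) ℝ}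
    (hH : ∀ i j, NegligibleInProb M.P fun n ω =>
      ENNReal.ofReal |hessian (T n ω) (M.δ (M.θ n)) i j - H i j|)
    {x : (Σ n, Ω n) → Param p q} (hx : ∀ᶠ w in probFilter M.P, x w ∈ M.big)
    (hd : Tendsto (fun w => ‖M.δ (x w) - M.δ (M.θ w.1)‖) (probFilter M.P) (𝓝 0)) :
    Tendsto (fun w => (M.obj T w (x w) - quad H (M.score T w) (M.dev w.1 (x w)))
      / (1 + ‖M.dev w.1 (x w)‖) ^ 2) (probFilter M.P) (𝓝 0) := by
  obtain ⟨η, hη0, hη, hle⟩ := exists_rate hd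
  have h1 : Tendsto (fun w : Σ n, Ω n => w.1 * (M.Q w.1 w.2 (x w) - T w.1 w.2 (M.δ (x w)))
      / (1 + ‖M.dev w.1 (x w)‖) ^ 2) (probFilter M.P) (𝓝 0) := by
    refine tendsto_of_tendsto_ofReal_abs (tendsto_of_tendsto_of_tendsto_of_le_of_le'
      tendsto_const_nhds (hobj.local_unif η hη0 hη).tendsto (.of_forall fun _ => zero_le) ?_)
    filter_upwards [hx, hle] with w hw hw'
    refine le_trans (le_of_eq ?_) (le_iSup₂_of_le (x w) hw (le_iSup_of_le hw' le_rfl))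
    rw [norm_dev, abs_div, abs_mul, abs_of_nonneg (Nat.cast_nonneg w.1 : (0 : ℝ) ≤ w.1),
      abs_of_nonneg (by positivity : 0 ≤ (1 + √w.1 * ‖M.δ (x w) - M.δ (M.θ w.1)‖) ^ 2),
      mul_div_assoc]
  have h2 : Tendsto (fun w : Σ n, Ω n => w.1 * M.remainder T w.1 w.2 (M.δ (x w))
      / (1 + ‖M.dev w.1 (x w)‖) ^ 2) (probFilter M.P) (𝓝 0) := by
    refine tendsto_of_tendsto_ofReal_abs (tendsto_of_tendsto_of_tendsto_of_le_of_le'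
      tendsto_const_nhds (hquad η hη0 hη).tendsto (.of_forall fun _ => zero_le) ?_)
    filter_upwards [hx, hle] with w hw hw'
    refine le_trans (le_of_eq ?_)
      (le_iSup₂_of_le (M.δ (x w)) ⟨x w, hw, rfl⟩ (le_iSup_of_le hw' le_rfl))
    rw [norm_dev, abs_div,
      abs_of_nonneg (by positivity : 0 ≤ (1 + √w.1 * ‖M.δ (x w) - M.δ (M.θ w.1)‖) ^ 2)]
  have h3 : Tendsto (fun w : Σ n, Ω n =>
      (quad (hessian (T w.1 w.2) (M.δ (M.θ w.1))) (M.score T w) (M.dev w.1 (x w))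
        - quad H (M.score T w) (M.dev w.1 (x w)))
      / (1 + ‖M.dev w.1 (x w)‖) ^ 2) (probFilter M.P) (𝓝 0) := by
    have hsum : Tendsto (fun w : Σ n, Ω n =>
        ∑ i, ∑ j, |hessian (T w.1 w.2) (M.δ (M.θ w.1)) i j - H i j|) (probFilter M.P) (𝓝 0) := by
      have h0 : ∀ i j, Tendsto (fun w : Σ n, Ω n =>
          |hessian (T w.1 w.2) (M.δ (M.θ w.1)) i j - H i j|) (probFilter M.P) (𝓝 0) := fun i j => by
        simpa using (tendsto_of_tendsto_ofReal_abs (hH i j).tendsto).abs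
      simpa using tendsto_finsetSum Finset.univ fun i _ =>
        tendsto_finsetSum Finset.univ fun j _ => h0 i j
    refine squeeze_zero_norm (fun w => ?_) hsum
    rw [norm_div, Real.norm_eq_abs, Real.norm_of_nonneg (sq_nonneg (1 + _)),
      div_le_iff₀ (by positivity)]
    refine (abs_quad_sub_quad_le _ _ _ _).trans ?_
    gcongr
    linarith [norm_nonneg (M.dev w.1 (x w))]
  have hadd := (h1.add h2).add h3
  simp only [add_zero] at hadd
  refine hadd.congr fun w => ?_
  rw [← add_div, ← add_div]
  congr 1
  have := M.mul_sub_reduced_eq T w (x w)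
  rw [obj]
  linarith

lemma eventually_obj_estim_le (hM : M.Framework) {x : (Σ n, Ω n) → Param p q}
    (hx : ∀ᶠ w in probFilter M.P, x w ∈ M.space) {ε : ℝ} (hε : 0 < ε) :
    ∀ᶠ w in probFilter M.P, M.obj T w (M.estim w) ≤ M.obj T w (x w) + ε := by
  have h := ENNReal.tendsto_nhds_zero.1 hM.est_min.tendsto (ENNReal.ofReal ε)
    (ENNReal.ofReal_pos.2 hε)
  filter_upwards [h, hx] with w hw hxw
  have h1 : ENNReal.ofReal (w.1 * (M.Q w.1 w.2 (M.est w.1 w.2) - M.Q w.1 w.2 (x w)))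
      ≤ ENNReal.ofReal ε := le_trans (le_iSup₂_of_le (x w) hxw le_rfl) hw
  have h2 := (ENNReal.ofReal_le_ofReal_iff hε.le).1 h1
  simp only [obj, estim]
  linarith

lemma continuousOn_δ (hsmooth : M.SmoothLink) : ContinuousOn M.δ M.big := by
  have h := hsmooth.continuousOn
  unfold δ stack
  refine (PiLp.continuous_toLp 2 _).comp_continuousOn (continuousOn_pi.2 fun i => ?_)
  rcases i with i | i
  · simp only [Sum.elim_inl]
    fun_prop
  · simp only [Sum.elim_inr]
    exact (EuclideanSpace.proj (𝕜 := ℝ) i).continuous.comp_continuousOn h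

lemma θlim_mem (hM : M.Framework) (hspace : M.RegularSpace) : M.θlim ∈ M.space :=
  hspace.isClosed.mem_of_tendsto hM.θ_tendsto (.of_forall hM.θ_mem)

lemma tendsto_δ (hM : M.Framework) (hsmooth : M.SmoothLink) {x : Param p q} (hx : x ∈ M.big) :
    Tendsto M.δ (𝓝 x) (𝓝 (M.δ x)) :=
  ((continuousOn_δ hsmooth).continuousAt (hM.isOpen_big.mem_nhds hx)).tendsto

/-- Consistency of the reduced-form parameters. -/
lemma tendsto_δ_estim (hM : M.Framework) (hsmooth : M.SmoothLink)
    (hobj : M.ReducedFormObjective T) (hident : M.ReducedFormIdentified T)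
    (hspace : M.RegularSpace) :
    Tendsto (fun w => M.δ (M.estim w)) (probFilter M.P) (𝓝 (M.δ M.θlim)) := by
  obtain ⟨T₀, hT₀, hTT₀, hsep⟩ := hident
  have hlim := hM.mem_big (θlim_mem hM hspace)
  have hθ : ∀ n, M.δ (M.θ n) ∈ M.reduced := fun n => ⟨_, hM.mem_big (hM.θ_mem n), rfl⟩
  have hδ : Tendsto (fun n => M.δ (M.θ n)) atTop (𝓝 (M.δ M.θlim)) :=
    (tendsto_δ hM hsmooth hlim).comp hM.θ_tendsto
  have hT₀θ : Tendsto (fun n => T₀ (M.δ (M.θ n))) atTop (𝓝 (T₀ (M.δ M.θlim))) :=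
    (hT₀ _ ⟨_, hlim, rfl⟩).tendsto.comp
      (tendsto_nhdsWithin_iff.2 ⟨hδ, .of_forall hθ⟩)
  refine tendsto_def.2 fun U hU => ?_
  obtain ⟨c, hc, hcU⟩ := hsep U hU
  have hε : 0 < c / 7 := by positivity
  have hε' := ENNReal.ofReal_pos.2 hε
  have e1 := ENNReal.tendsto_nhds_zero.1 hTT₀.tendsto _ hε'
  have e2 := ENNReal.tendsto_nhds_zero.1 hobj.unif.tendsto _ hε'
  have e3 := eventually_obj_estim_le (T := T) hM (x := fun w => M.θ w.1)
    (.of_forall fun w => hM.θ_mem w.1) hε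
  have e4 := tendsto_fst_probFilter (P := M.P) |>.eventually
    (hT₀θ.eventually (gt_mem_nhds (lt_add_of_pos_right _ hε)))
  have e5 := tendsto_fst_probFilter (P := M.P) |>.eventually (eventually_ge_atTop 1)
  filter_upwards [e1, e2, e3, e4, e5] with w h1 h2 h3 h4 h5
  by_contra hU'
  have hest : M.estim w ∈ M.big := hM.mem_big (hM.est_mem _ _)
  have hred : M.δ (M.estim w) ∈ M.reduced := ⟨_, hest, rfl⟩
  have b1 : ∀ d ∈ M.reduced, |T w.1 w.2 d - T₀ d| ≤ c / 7 := fun d hd =>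
    (ENNReal.ofReal_le_ofReal_iff hε.le).1 (le_trans (le_iSup₂_of_le d hd le_rfl) h1)
  have b2 : ∀ x ∈ M.big, |M.Q w.1 w.2 x - T w.1 w.2 (M.δ x)| ≤ c / 7 := fun x hx =>
    (ENNReal.ofReal_le_ofReal_iff hε.le).1 (le_trans (le_iSup₂_of_le x hx le_rfl) h2)
  have b3 : M.Q w.1 w.2 (M.estim w) ≤ M.Q w.1 w.2 (M.θ w.1) + c / 7 := by
    have hn : (1 : ℝ) ≤ w.1 := by exact_mod_cast h5
    simp only [obj] at h3
    nlinarith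
  have b4 := hcU _ ⟨hred, hU'⟩
  have c1 := abs_le.1 (b1 _ hred)
  have c2 := abs_le.1 (b1 _ (hθ w.1))
  have c3 := abs_le.1 (b2 _ hest)
  have c4 := abs_le.1 (b2 _ (hM.mem_big (hM.θ_mem w.1)))
  linarith [c1.1, c1.2, c2.1, c2.2, c3.1, c3.2, c4.1, c4.2]

lemma tendsto_norm_δ_estim_sub (hM : M.Framework) (hsmooth : M.SmoothLink)
    (hobj : M.ReducedFormObjective T) (hident : M.ReducedFormIdentified T)
    (hspace : M.RegularSpace) :
    Tendsto (fun w => ‖M.δ (M.estim w) - M.δ (M.θ w.1)‖) (probFilter M.P) (𝓝 0) := by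
  have hδ : Tendsto (fun w : Σ n, Ω n => M.δ (M.θ w.1)) (probFilter M.P) (𝓝 (M.δ M.θlim)) :=
    ((tendsto_δ hM hsmooth (hM.mem_big (θlim_mem hM hspace))).comp hM.θ_tendsto).comp
      tendsto_fst_probFilter
  simpa using ((tendsto_δ_estim hM hsmooth hobj hident hspace).sub hδ).norm

/-- The assumptions common to all identification regimes, apart from the limit law of the
score. -/
structure Conditions (M : Model p q r Ω) (T : ∀ n, Ω n → Vec (Fin p ⊕ Fin r) → ℝ)
    (H : Matrix (Fin p ⊕ Fin r) (Fin p ⊕ Fin r) ℝ) : Prop where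
  framework : M.Framework
  smooth : M.SmoothLink
  objective : M.ReducedFormObjective T
  identified : M.ReducedFormIdentified T
  regular : M.RegularSpace
  expansion : M.QuadraticExpansion T
  posDef : H.PosDef
  hess : ∀ i j, NegligibleInProb M.P fun n ω =>
    ENNReal.ofReal |hessian (T n ω) (M.δ (M.θ n)) i j - H i j|

/-- On events on which the score converges, the reduced-form deviation of the estimator stays
bounded. -/
lemma exists_norm_dev_estim_le {H : Matrix (Fin p ⊕ Fin r) (Fin p ⊕ Fin r) ℝ}
    (h : M.Conditions T H)
    {l : Filter (Σ n, Ω n)} (hl : l ≤ probFilter M.P) {y : Vec (Fin p ⊕ Fin r)}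
    (hy : Tendsto (M.score T) l (𝓝 y)) :
    ∃ K : ℝ, ∀ᶠ w in l, ‖M.dev w.1 (M.estim w)‖ ≤ K := by
  obtain ⟨hM, hsmooth, hobj, hident, hspace, hquad, hHpos, hH⟩ := h
  obtain ⟨c, hc, hcH⟩ := exists_pos_mul_sq_le hHpos
  have e1 := (tendsto_expansion hobj hquad hH (x := M.estim)
    (.of_forall fun w => hM.mem_big (hM.est_mem _ _))
    (tendsto_norm_δ_estim_sub hM hsmooth hobj hident hspace)).mono_left hl
  have e2 := (tendsto_expansion hobj hquad hH (x := fun w => M.θ w.1)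
    (.of_forall fun w => hM.mem_big (hM.θ_mem _))
    (by simpa using tendsto_const_nhds)).mono_left hl
  have e3 := (eventually_obj_estim_le (T := T) hM (x := fun w => M.θ w.1)
    (.of_forall fun w => hM.θ_mem w.1) one_pos).filter_mono hl
  -- the tolerance `c / 8` leaves a positive multiple of the squared norm after absorption
  have hc8 : 0 < c / 8 := by positivity
  have f1 := e1.abs.eventually (gt_mem_nhds (by simpa using hc8 : |(0 : ℝ)| < c / 8))
  have f2 := e2.abs.eventually (gt_mem_nhds (by simp : |(0 : ℝ)| < 1))
  have f3 := hy.norm.eventually (gt_mem_nhds (lt_add_one ‖y‖))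
  refine ⟨max 1 (4 / c * (‖y‖ + 1 + 2 + c / 4)), ?_⟩
  filter_upwards [e3, f1, f2, f3] with w h3 g1 g2 g3
  set s := M.dev w.1 (M.estim w) with hs
  have hdev0 : M.dev w.1 (M.θ w.1) = 0 := by simp [dev]
  have g2' : |M.obj T w (M.θ w.1)| < 1 := by
    simpa [hdev0, quad] using g2
  have hden : 0 < (1 + ‖s‖) ^ 2 := by positivity
  rw [abs_div, abs_of_pos hden, div_lt_iff₀ hden] at g1
  have k1 := (abs_lt.1 g1).1
  have k2 := (abs_lt.1 g2').2
  have k3 := (abs_le.1 (abs_dotProduct_le (M.score T w) s)).1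
  have k4 := hcH s
  have k5 : ‖M.score T w‖ * ‖s‖ ≤ (‖y‖ + 1) * ‖s‖ := by gcongr
  have k6 : (1 + ‖s‖) ^ 2 ≤ 2 + 2 * ‖s‖ ^ 2 := by nlinarith [sq_nonneg (1 - ‖s‖)]
  have k7 : c / 4 * ‖s‖ ^ 2 ≤ (‖y‖ + 1) * ‖s‖ + (2 + c / 4) := by
    unfold quad at k1
    nlinarith
  rcases le_total ‖s‖ 1 with hle | hle
  · exact le_max_of_le_left hle
  · refine le_max_of_le_right ?_
    have k8 : c / 4 * ‖s‖ * ‖s‖ ≤ (‖y‖ + 1 + 2 + c / 4) * ‖s‖ := by nlinarith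
    have k9 := le_of_mul_le_mul_right k8 (by linarith)
    calc ‖s‖ = 4 / c * (c / 4 * ‖s‖) := by field_simp
      _ ≤ _ := by gcongr

/-- The limit of the criterion at the estimator is at most its limit along any deterministic
sequence of parameters. -/
lemma quad_le_quad {H : Matrix (Fin p ⊕ Fin r) (Fin p ⊕ Fin r) ℝ}
    (h : M.Conditions T H)
    {l : Filter (Σ n, Ω n)} [l.NeBot] (hl : l ≤ probFilter M.P) {y : Vec (Fin p ⊕ Fin r)}
    (hy : Tendsto (M.score T) l (𝓝 y)) {s₀ s₁ : Vec (Fin p ⊕ Fin r)}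
    (hs₀ : Tendsto (fun w => M.dev w.1 (M.estim w)) l (𝓝 s₀))
    {x : ℕ → Param p q} (hx : ∀ᶠ n in atTop, x n ∈ M.space)
    (hs₁ : Tendsto (fun n => M.dev n (x n)) atTop (𝓝 s₁)) :
    quad H y s₀ ≤ quad H y s₁ := by
  obtain ⟨hM, hsmooth, hobj, hident, hspace, hquad, -, hH⟩ := h
  have hfst := tendsto_fst_probFilter (P := M.P)
  have hxw : ∀ᶠ w : Σ n, Ω n in probFilter M.P, x w.1 ∈ M.space := hfst.eventually hx
  have hsqrt : Tendsto (fun n : ℕ => √(n : ℝ)) atTop atTop :=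
    Real.tendsto_sqrt_atTop.comp tendsto_natCast_atTop_atTop
  have hdx : Tendsto (fun n => ‖M.δ (x n) - M.δ (M.θ n)‖) atTop (𝓝 0) := by
    have h1 := hs₁.norm.mul (tendsto_inv_atTop_zero.comp hsqrt)
    rw [mul_zero] at h1
    refine h1.congr' ?_
    filter_upwards [eventually_ge_atTop 1] with n hn
    have : 0 < √(n : ℝ) := Real.sqrt_pos.2 (by exact_mod_cast hn)
    simp only [Function.comp_apply, norm_dev]
    field_simp
  have hs₁' : Tendsto (fun w : Σ n, Ω n => M.dev w.1 (x w.1)) l (𝓝 s₁) :=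
    (hs₁.comp hfst).mono_left hl
  have key : ∀ {z : (Σ n, Ω n) → Param p q} {s : Vec (Fin p ⊕ Fin r)},
      (∀ᶠ w in probFilter M.P, z w ∈ M.big) →
      Tendsto (fun w => ‖M.δ (z w) - M.δ (M.θ w.1)‖) (probFilter M.P) (𝓝 0) →
      Tendsto (fun w => M.dev w.1 (z w)) l (𝓝 s) →
      Tendsto (fun w => M.obj T w (z w)) l (𝓝 (quad H y s)) := by
    intro z s hz hzd hzs
    have e1 := ((tendsto_expansion hobj hquad hH hz hzd).mono_left hl).mul
      ((hzs.norm.const_add 1).pow 2)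
    have e2 := ((continuous_quad H).tendsto (y, s)).comp (hy.prodMk_nhds hzs)
    have e3 := e1.add e2
    rw [zero_mul, zero_add] at e3
    refine e3.congr fun w => ?_
    have : (1 + ‖M.dev w.1 (z w)‖) ^ 2 ≠ 0 := by positivity
    simp only [Function.comp_apply]
    field_simp
    ring
  have k0 := key (.of_forall fun w => hM.mem_big (hM.est_mem _ _))
    (tendsto_norm_δ_estim_sub hM hsmooth hobj hident hspace) hs₀
  have k1 := key (hxw.mono fun w hw => hM.mem_big hw) (hdx.comp hfst) hs₁'
  refine le_of_forall_pos_le_add fun ε hε => ?_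
  exact le_of_tendsto_of_tendsto k0 (k1.add_const ε)
    ((eventually_obj_estim_le hM hxw hε).filter_mono hl)

end Model

/-! ### Linearization of the link function -/

section Euclidean

variable {ι κ : Type*} [Fintype ι] [DecidableEq ι] [Fintype κ]

/-- A matrix as a continuous linear map between Euclidean spaces. The correspondence is linear,
hence entrywise convergence of matrices gives convergence in operator norm. -/
def matCLM : Matrix κ ι ℝ →ₗ[ℝ] Vec ι →L[ℝ] Vec κ :=
  (LinearMap.toContinuousLinearMap.toLinearMap : (Vec ι →ₗ[ℝ] Vec κ) →ₗ[ℝ] _) ∘ₗ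
    Matrix.toEuclideanLin.toLinearMap

lemma matCLM_apply (A : Matrix κ ι ℝ) (v : Vec ι) :
    matCLM A v = WithLp.toLp 2 (A *ᵥ v.ofLp) := rfl

lemma continuous_matCLM : Continuous (matCLM : Matrix κ ι ℝ → Vec ι →L[ℝ] Vec κ) :=
  LinearMap.continuous_of_finiteDimensional _

lemma matCLM_jacobian (f : Vec ι → Vec κ) (x : Vec ι) :
    matCLM (jacobian f x) = fderiv ℝ f x := by
  refine ContinuousLinearMap.coe_injective ((EuclideanSpace.basisFun ι ℝ).toBasis.ext fun j => ?_)
  simp only [OrthonormalBasis.coe_toBasis, EuclideanSpace.basisFun_apply,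
    ContinuousLinearMap.coe_coe, matCLM_apply]
  ext i
  simp [jacobian]

end Euclidean

lemma norm_stack_zero {p r : ℕ} (v : Vec (Fin r)) : ‖stack (0 : Vec (Fin p)) v‖ = ‖v‖ := by
  simp [stack, EuclideanSpace.norm_eq, Fintype.sum_sum_type]

lemma stack_sub {p r : ℕ} (a a' : Vec (Fin p)) (b b' : Vec (Fin r)) :
    stack (a - a') (b - b') = stack a b - stack a' b' := by
  ext i; rcases i with i | i <;> simp [stack]

lemma smul_stack {p r : ℕ} (t : ℝ) (a : Vec (Fin p)) (b : Vec (Fin r)) :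
    t • stack a b = stack (t • a) (t • b) := by
  ext i; rcases i with i | i <;> simp [stack]

lemma continuous_stack {p r : ℕ} :
    Continuous fun z : Vec (Fin p) × Vec (Fin r) => stack z.1 z.2 := by
  unfold stack
  refine (PiLp.continuous_toLp 2 _).comp (continuous_pi fun i => ?_)
  rcases i with i | i <;> simp only [Sum.elim_inl, Sum.elim_inr] <;> fun_prop

lemma norm_fst_le_norm_stack {p r : ℕ} (a : Vec (Fin p)) (b : Vec (Fin r)) :
    ‖a‖ ≤ ‖stack a b‖ := by
  simp only [stack, EuclideanSpace.norm_eq, Fintype.sum_sum_type]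
  exact Real.sqrt_le_sqrt (by simpa using Finset.sum_nonneg fun i _ => sq_nonneg _)

lemma norm_snd_le_norm_stack {p r : ℕ} (a : Vec (Fin p)) (b : Vec (Fin r)) :
    ‖b‖ ≤ ‖stack a b‖ := by
  simp only [stack, EuclideanSpace.norm_eq, Fintype.sum_sum_type]
  exact Real.sqrt_le_sqrt (by simpa using Finset.sum_nonneg fun i _ => sq_nonneg _)

namespace Model

variable {p q r : ℕ} {Ω : ℕ → Type*} [∀ n, MeasurableSpace (Ω n)] {M : Model p q r Ω}

lemma hasStrictFDerivAt_τ (hM : M.Framework) (hsmooth : M.SmoothLink) {x : Param p q}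
    (hx : x ∈ M.big) : HasStrictFDerivAt M.τ (fderiv ℝ M.τ x) x :=
  (hsmooth.contDiffAt (hM.isOpen_big.mem_nhds hx)).hasStrictFDerivAt (by norm_num)

lemma matCLM_jacPi (hM : M.Framework) (hsmooth : M.SmoothLink) {x : Param p q}
    (hx : x ∈ M.big) (v : Vec (Fin p)) : matCLM (M.jacPi x) v = fderiv ℝ M.τ x (v, 0) := by
  rw [jacPi, matCLM_jacobian]
  have h := HasFDerivAt.comp (𝕜 := ℝ) (g := M.τ) (f := fun a => (a, x.2)) x.1
    (hasStrictFDerivAt_τ hM hsmooth hx).hasFDerivAt (hasFDerivAt_prodMk_left x.1 x.2)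
  have h2 : fderiv ℝ (fun a => M.τ (a, x.2)) x.1 = _ := h.fderiv
  rw [h2]
  simp

lemma hasFDerivAt_τ_snd (hM : M.Framework) (hsmooth : M.SmoothLink) {x : Param p q}
    (hx : x ∈ M.big) : HasFDerivAt (fun b => M.τ (x.1, b)) (matCLM (M.jacBeta x)) x.2 := by
  have h := HasFDerivAt.comp (𝕜 := ℝ) (g := M.τ) (f := fun b => (x.1, b)) x.2
    (hasStrictFDerivAt_τ hM hsmooth hx).hasFDerivAt (hasFDerivAt_prodMk_right x.1 x.2)
  rw [jacBeta, matCLM_jacobian]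
  exact h.differentiableAt.hasFDerivAt

lemma jacBeta_apply (hM : M.Framework) (hsmooth : M.SmoothLink) {x : Param p q}
    (hx : x ∈ M.big) (i : Fin r) (j : Fin q) :
    M.jacBeta x i j = (fderiv ℝ M.τ x (0, EuclideanSpace.single j 1)).ofLp i := by
  have h := HasFDerivAt.comp (𝕜 := ℝ) (g := M.τ) (f := fun b => (x.1, b)) x.2
    (hasStrictFDerivAt_τ hM hsmooth hx).hasFDerivAt (hasFDerivAt_prodMk_right x.1 x.2)
  have h2 : fderiv ℝ (fun b => M.τ (x.1, b)) x.2 = _ := h.fderiv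
  simp only [jacBeta, jacobian, h2]
  simp

lemma continuousOn_jacBeta (hM : M.Framework) (hsmooth : M.SmoothLink) (i : Fin r) (j : Fin q) :
    ContinuousOn (fun x => M.jacBeta x i j) M.big := by
  have h := hsmooth.continuousOn_fderiv_of_isOpen hM.isOpen_big (by norm_num)
  have h2 : ContinuousOn (fun x => (fderiv ℝ M.τ x (0, EuclideanSpace.single j 1)).ofLp i)
      M.big :=
    (EuclideanSpace.proj (𝕜 := ℝ) i).continuous.comp_continuousOn
      (h.clm_apply continuousOn_const)
  exact h2.congr fun x hx => jacBeta_apply hM hsmooth hx i j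

/-- Expansion of the link in the first parameter, uniform in nearby second parameters. -/
lemma isLittleO_τ_fst (hM : M.Framework) (hsmooth : M.SmoothLink) {x : Param p q}
    (hx : x ∈ M.big) {α : Type*} {l : Filter α} {a a' : α → Vec (Fin p)} {b : α → Vec (Fin q)}
    (ha : Tendsto a l (𝓝 x.1)) (ha' : Tendsto a' l (𝓝 x.1)) (hb : Tendsto b l (𝓝 x.2)) :
    (fun i => M.τ (a i, b i) - M.τ (a' i, b i) - matCLM (M.jacPi x) (a i - a' i))
      =o[l] fun i => a i - a' i := by
  have h := (hasStrictFDerivAt_τ hM hsmooth hx).isLittleO.comp_tendsto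
    ((ha.prodMk_nhds hb).prodMk_nhds (ha'.prodMk_nhds hb))
  have h1 : (fun i => ((a i, b i) - (a' i, b i) : Param p q)) =O[l] fun i => a i - a' i :=
    IsBigO.of_bound 1 (.of_forall fun i => by simp [Prod.norm_def])
  refine (h.trans_isBigO h1).congr_left fun i => ?_
  simp only [Function.comp_apply, matCLM_jacPi hM hsmooth hx, Prod.mk_sub_mk, sub_self]

/-- The derivatives `∂_β τ(π_n, β)`, multiplied by `a_n`, converge to `C` as `n → ∞` and
`β → β_*`. This is what strong and semi-strong sequences have in common. -/
def DerivLimit (M : Model p q r Ω) (a : ℕ → ℝ) (C : Matrix (Fin r) (Fin q) ℝ) : Prop :=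
  Tendsto (fun z : ℕ × Vec (Fin q) => a z.1 • M.jacBeta ((M.θ z.1).1, z.2))
    (atTop ×ˢ 𝓝 M.θlim.2) (𝓝 C)

lemma tendsto_fst_θ (hM : M.Framework) {α : Type*} {l : Filter α} {n : α → ℕ}
    (hn : Tendsto n l atTop) : Tendsto (fun i => (M.θ (n i)).1) l (𝓝 M.θlim.1) :=
  ((continuous_fst.tendsto _).comp hM.θ_tendsto).comp hn

lemma tendsto_snd_θ (hM : M.Framework) {α : Type*} {l : Filter α} {n : α → ℕ}
    (hn : Tendsto n l atTop) : Tendsto (fun i => (M.θ (n i)).2) l (𝓝 M.θlim.2) :=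
  ((continuous_snd.tendsto _).comp hM.θ_tendsto).comp hn

/-- Expansion of the link in the second parameter at `π_n`, by the mean value inequality. -/
lemma isLittleO_τ_snd (hM : M.Framework) (hsmooth : M.SmoothLink) (hspace : M.RegularSpace)
    {a : ℕ → ℝ} {C : Matrix (Fin r) (Fin q) ℝ} (hC : M.DerivLimit a C)
    {α : Type*} {l : Filter α} {n : α → ℕ} {b b' : α → Vec (Fin q)} (hn : Tendsto n l atTop)
    (hb : Tendsto b l (𝓝 M.θlim.2)) (hb' : Tendsto b' l (𝓝 M.θlim.2)) :
    (fun i => a (n i) • (M.τ ((M.θ (n i)).1, b i) - M.τ ((M.θ (n i)).1, b' i))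
      - matCLM C (b i - b' i)) =o[l] fun i => b i - b' i := by
  refine isLittleO_iff.2 fun ε hε => ?_
  have h1 : Tendsto (fun z : ℕ × Vec (Fin q) => matCLM (a z.1 • M.jacBeta ((M.θ z.1).1, z.2)))
      (atTop ×ˢ 𝓝 M.θlim.2) (𝓝 (matCLM C)) := (continuous_matCLM.tendsto C).comp hC
  have h2 : ∀ᶠ z : ℕ × Vec (Fin q) in atTop ×ˢ 𝓝 M.θlim.2, ((M.θ z.1).1, z.2) ∈ M.big := by
    have : Tendsto (fun z : ℕ × Vec (Fin q) => ((M.θ z.1).1, z.2)) (atTop ×ˢ 𝓝 M.θlim.2)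
        (𝓝 M.θlim) := (tendsto_fst_θ hM tendsto_fst).prodMk_nhds tendsto_snd
    exact this (hM.isOpen_big.mem_nhds (hM.mem_big (θlim_mem hM hspace)))
  have h3 := (Metric.tendsto_nhds.1 h1 ε hε).and h2
  obtain ⟨⟨N, ρ⟩, ⟨-, hρ⟩, hNρ⟩ :=
    (atTop_basis.prod (Metric.nhds_basis_ball (x := M.θlim.2))).eventually_iff.1 h3
  filter_upwards [hn.eventually (eventually_ge_atTop N), hb (Metric.ball_mem_nhds _ hρ),
    hb' (Metric.ball_mem_nhds _ hρ)] with i hi hbi hbi'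
  have hder : ∀ z ∈ Metric.ball M.θlim.2 ρ,
      HasFDerivWithinAt (fun z => a (n i) • M.τ ((M.θ (n i)).1, z))
        (matCLM (a (n i) • M.jacBeta ((M.θ (n i)).1, z))) (Metric.ball M.θlim.2 ρ) z := by
    intro z hz
    have hbig := (hNρ (x := (n i, z)) ⟨hi, hz⟩).2
    rw [map_smul]
    exact ((hasFDerivAt_τ_snd hM hsmooth hbig).const_smul (a (n i))).hasFDerivWithinAt
  have hle : ∀ z ∈ Metric.ball M.θlim.2 ρ,
      ‖matCLM (a (n i) • M.jacBeta ((M.θ (n i)).1, z)) - matCLM C‖ ≤ ε := fun z hz => by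
    rw [← dist_eq_norm]
    exact (hNρ (x := (n i, z)) ⟨hi, hz⟩).1.le
  have := (convex_ball M.θlim.2 ρ).norm_image_sub_le_of_norm_hasFDerivWithin_le' hder hle hbi' hbi
  rwa [← smul_sub] at this

/-- The matrix `D_*` as a continuous linear map. -/
def linkDeriv (M : Model p q r Ω) (C : Matrix (Fin r) (Fin q) ℝ) :
    Param p q →L[ℝ] Vec (Fin p ⊕ Fin r) :=
  LinearMap.toContinuousLinearMap
    { toFun := fun ψ => WithLp.toLp 2 (M.Dstar C *ᵥ col ψ)
      map_add' := fun ψ φ => by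
        have : col (ψ + φ) = col ψ + col φ := by
          ext i; rcases i with i | i <;> simp [col]
        rw [this, mulVec_add, WithLp.toLp_add]
      map_smul' := fun t ψ => by
        have : col (t • ψ) = t • col ψ := by
          ext i; rcases i with i | i <;> simp [col]
        rw [this, mulVec_smul, WithLp.toLp_smul, RingHom.id_apply] }

lemma linkDeriv_apply (C : Matrix (Fin r) (Fin q) ℝ) (ψ : Param p q) :
    M.linkDeriv C ψ = WithLp.toLp 2 (M.Dstar C *ᵥ col ψ) := rfl

lemma linkDeriv_eq_stack (C : Matrix (Fin r) (Fin q) ℝ) (ψ : Param p q) :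
    M.linkDeriv C ψ = stack ψ.1 (matCLM (M.jacPi M.θlim) ψ.1 + matCLM C ψ.2) := by
  rw [linkDeriv_apply, Dstar, col, fromBlocks_mulVec]
  ext i
  rcases i with i | i <;> simp [stack, matCLM_apply]

lemma mulVec_injective_of_rank {C : Matrix (Fin r) (Fin q) ℝ} (hC : C.rank = q) :
    Function.Injective C.mulVec := by
  have h := LinearMap.finrank_range_add_finrank_ker C.mulVecLin
  have h' : Module.finrank ℝ (LinearMap.range C.mulVecLin) = q := hC
  rw [h', Module.finrank_fin_fun] at h
  have h2 : LinearMap.ker C.mulVecLin = ⊥ := Submodule.finrank_eq_zero.1 (by omega)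
  exact LinearMap.ker_eq_bot.1 h2

lemma linkDeriv_injective {C : Matrix (Fin r) (Fin q) ℝ} (hC : C.rank = q) :
    Function.Injective (M.linkDeriv C) := by
  refine (injective_iff_map_eq_zero _).2 fun ψ hψ => ?_
  rw [linkDeriv_eq_stack] at hψ
  have h1 : ψ.1 = 0 := by
    ext i
    simpa [stack] using congrArg (fun v => v.ofLp (Sum.inl i)) hψ
  have h2 : C *ᵥ ψ.2.ofLp = C *ᵥ 0 := by
    rw [h1] at hψ
    ext i
    simpa [stack, matCLM_apply] using congrArg (fun v => v.ofLp (Sum.inr i)) hψ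
  have h3 := mulVec_injective_of_rank hC h2
  refine Prod.ext h1 ?_
  ext i
  exact congrFun h3 i

lemma dev_eq_stack (n : ℕ) (x : Param p q) :
    M.dev n x = stack (√n • (x.1 - (M.θ n).1)) (√n • (M.τ x - M.τ (M.θ n))) := by
  rw [dev, δ, δ, ← stack_sub, smul_stack]

/-- The reduced-form deviation is linear in the local parameter, up to a negligible error. -/
lemma isLittleO_dev (hM : M.Framework) (hsmooth : M.SmoothLink) (hspace : M.RegularSpace)
    {a : ℕ → ℝ} (ha : ∀ n, 0 < a n) {C : Matrix (Fin r) (Fin q) ℝ} (hC : M.DerivLimit a C)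
    {α : Type*} {l : Filter α} {n : α → ℕ} {x : α → Param p q} (hn : Tendsto n l atTop)
    (hx : Tendsto x l (𝓝 M.θlim)) :
    (fun i => M.dev (n i) (x i) - M.linkDeriv C (M.rescale a (n i) (x i)))
      =o[l] fun i => M.rescale a (n i) (x i) := by
  have hx1 := (continuous_fst.tendsto M.θlim).comp hx
  have hx2 := (continuous_snd.tendsto M.θlim).comp hx
  have e1 := isLittleO_τ_fst hM hsmooth (hM.mem_big (θlim_mem hM hspace)) hx1
    (tendsto_fst_θ hM hn) hx2
  have e2 := isLittleO_τ_snd hM hsmooth hspace hC hn hx2 (tendsto_snd_θ hM hn)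
  have f1 := (isBigO_refl (fun i => √(n i : ℝ)) l).smul_isLittleO e1
  have f2 := (isBigO_refl (fun i => √(n i : ℝ) / a (n i)) l).smul_isLittleO e2
  have g1 : (fun i => √(n i : ℝ) • ((Prod.fst ∘ x) i - (M.θ (n i)).1))
      =O[l] fun i => M.rescale a (n i) (x i) :=
    IsBigO.of_bound 1 (.of_forall fun i => by
      rw [one_mul]; exact norm_fst_le (M.rescale a (n i) (x i)))
  have g2 : (fun i => (√(n i : ℝ) / a (n i)) • ((Prod.snd ∘ x) i - (M.θ (n i)).2))
      =O[l] fun i => M.rescale a (n i) (x i) :=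
    IsBigO.of_bound 1 (.of_forall fun i => by
      rw [one_mul]; exact norm_snd_le (M.rescale a (n i) (x i)))
  refine IsLittleO.of_norm_left (((f1.trans_isBigO g1).add (f2.trans_isBigO g2)).norm_left.congr_left
    fun i => ?_)
  have ha' := (ha (n i)).ne'
  rw [linkDeriv_eq_stack, dev_eq_stack, ← stack_sub]
  have h1 : √(n i : ℝ) • ((x i).1 - (M.θ (n i)).1) - (M.rescale a (n i) (x i)).1 = 0 := sub_self _
  rw [h1, norm_stack_zero]
  congr 1
  have k1 := (matCLM (M.jacPi M.θlim)).map_smul √(n i : ℝ) ((x i).1 - (M.θ (n i)).1)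
  have k2 := (matCLM C).map_smul (√(n i : ℝ) / a (n i)) ((x i).2 - (M.θ (n i)).2)
  simp only [rescale, Function.comp_apply, k1, k2]
  simp only [smul_sub, smul_smul, div_mul_cancel₀ _ ha']
  abel

end Model

/-! ### Kuratowski limits and the limit criteria -/

section Kuratowski

variable {X : Type*}

/-- Limits of points of the sets of a Kuratowski convergent sequence belong to the limit set. -/
lemma KuratowskiTendsto.mem_of_tendsto [PseudoEMetricSpace X] [WeaklyLocallyCompactSpace X]
    {A : ℕ → Set X} {B : Set X} (h : KuratowskiTendsto A B) (hB : IsClosed B) {α : Type*}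
    {l : Filter α} [l.NeBot] {n : α → ℕ} (hn : Tendsto n l atTop) {v : α → X} {x : X}
    (hv : Tendsto v l (𝓝 x)) (hmem : ∀ᶠ i in l, v i ∈ A (n i)) : x ∈ B := by
  obtain ⟨K, hK, hKx⟩ := exists_compact_mem_nhds x
  rw [← hB.closure_eq, Metric.mem_closure_iff_infEDist_zero]
  have h1 : Tendsto (fun i => Metric.infEDist (v i) B) l (𝓝 0) := by
    refine tendsto_of_tendsto_of_tendsto_of_le_of_le' tendsto_const_nhds ((h K hK).comp hn)
      (.of_forall fun _ => zero_le) ?_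
    filter_upwards [hmem, hv hKx] with i hi hi'
    exact le_max_of_le_left (le_iSup₂_of_le (v i) ⟨hi, hi'⟩ le_rfl)
  exact tendsto_nhds_unique ((Metric.continuous_infEDist.tendsto x).comp hv) h1

/-- A point whose distances to a sequence of sets tend to zero is a limit of points of the sets. -/
lemma exists_tendsto_of_infEDist [PseudoEMetricSpace X] [Nonempty X] {A : ℕ → Set X} {x : X}
    (h : Tendsto (fun n => Metric.infEDist x (A n)) atTop (𝓝 0)) :
    ∃ u : ℕ → X, (∀ᶠ n in atTop, u n ∈ A n) ∧ Tendsto u atTop (𝓝 x) := by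
  have hex : ∀ n, ∃ u : X, Metric.infEDist x (A n) < ⊤ → u ∈ A n ∧
      edist x u < Metric.infEDist x (A n) + (n : ℝ≥0∞)⁻¹ := by
    intro n
    by_cases hlt : Metric.infEDist x (A n) < ⊤
    · have : Metric.infEDist x (A n) < Metric.infEDist x (A n) + (n : ℝ≥0∞)⁻¹ :=
        ENNReal.lt_add_right hlt.ne (ENNReal.inv_ne_zero.2 (ENNReal.natCast_ne_top n))
      obtain ⟨u, hu, hu'⟩ := Metric.infEDist_lt_iff.1 this
      exact ⟨u, fun _ => ⟨hu, hu'⟩⟩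
    · exact ⟨Classical.arbitrary X, fun h => (hlt h).elim⟩
  choose u hu using hex
  have hfin : ∀ᶠ n in atTop, Metric.infEDist x (A n) < ⊤ :=
    h.eventually (gt_mem_nhds ENNReal.zero_lt_top)
  refine ⟨u, hfin.mono fun n hn => (hu n hn).1, ?_⟩
  rw [tendsto_iff_edist_tendsto_0]
  have h0 := h.add ENNReal.tendsto_inv_nat_nhds_zero
  rw [add_zero] at h0
  refine tendsto_of_tendsto_of_tendsto_of_le_of_le' tendsto_const_nhds h0
    (.of_forall fun _ => zero_le) ?_
  filter_upwards [hfin] with n hn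
  rw [edist_comm]
  exact (hu n hn).2.le

lemma KuratowskiTendsto.exists_tendsto [PseudoEMetricSpace X] {A : ℕ → Set X} {B : Set X}
    (h : KuratowskiTendsto A B) {x : X} (hx : x ∈ B) :
    ∃ u : ℕ → X, (∀ᶠ n in atTop, u n ∈ A n) ∧ Tendsto u atTop (𝓝 x) := by
  have : Nonempty X := ⟨x⟩
  refine exists_tendsto_of_infEDist (tendsto_of_tendsto_of_tendsto_of_le_of_le
    tendsto_const_nhds (h {x} isCompact_singleton) (fun _ => zero_le) fun n => ?_)
  exact le_max_of_le_right (le_iSup₂_of_le x ⟨hx, rfl⟩ le_rfl)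

end Kuratowski

section CompleteSquare

variable {ι : Type*} [Fintype ι]

lemma dotProduct_mulVec_comm {A : Matrix ι ι ℝ} (hA : A.IsHermitian) (u v : ι → ℝ) :
    u ⬝ᵥ (A *ᵥ v) = v ⬝ᵥ (A *ᵥ u) := by
  have hT : Aᵀ = A := by simpa using hA.eq
  rw [dotProduct_mulVec, dotProduct_comm, ← mulVec_transpose, hT]

lemma complete_square {A : Matrix ι ι ℝ} (hA : A.IsHermitian) {z w : ι → ℝ} (hz : A *ᵥ z = -w)
    (v : ι → ℝ) :
    ((z - v) ⬝ᵥ (A *ᵥ (z - v))) / 2 - (z ⬝ᵥ (A *ᵥ z)) / 2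
      = w ⬝ᵥ v + 1 / 2 * (v ⬝ᵥ (A *ᵥ v)) := by
  have h1 : z ⬝ᵥ (A *ᵥ v) = -(w ⬝ᵥ v) := by
    rw [dotProduct_mulVec_comm hA, hz, dotProduct_neg, dotProduct_comm]
  have h2 : v ⬝ᵥ (A *ᵥ z) = -(w ⬝ᵥ v) := by
    rw [hz, dotProduct_neg, dotProduct_comm]
  rw [mulVec_sub, dotProduct_sub, sub_dotProduct, sub_dotProduct, h1, h2]
  ring

lemma dotProduct_mulVec_conj {κ : Type*} [Fintype κ] (A : Matrix κ κ ℝ) (D : Matrix κ ι ℝ)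
    (u v : ι → ℝ) : u ⬝ᵥ ((Dᵀ * A * D) *ᵥ v) = (D *ᵥ u) ⬝ᵥ (A *ᵥ (D *ᵥ v)) := by
  rw [← mulVec_mulVec, ← mulVec_mulVec, dotProduct_mulVec, vecMul_transpose]

lemma quad_add_div_two {H : Matrix ι ι ℝ} (hH : H.IsHermitian) (y s t : Vec ι) :
    quad H y ((1 / 2 : ℝ) • s + (1 / 2 : ℝ) • t) = (quad H y s + quad H y t) / 2
      - 1 / 8 * ((s - t).ofLp ⬝ᵥ (H *ᵥ (s - t).ofLp)) := by
  have h := dotProduct_mulVec_comm hH s.ofLp t.ofLp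
  simp only [quad, WithLp.ofLp_add, WithLp.ofLp_smul, WithLp.ofLp_sub, mulVec_add, mulVec_sub,
    mulVec_smul, dotProduct_add, add_dotProduct, dotProduct_sub, sub_dotProduct, dotProduct_smul,
    smul_dotProduct, smul_eq_mul, h]
  ring

end CompleteSquare

namespace Model

variable {p q r : ℕ} {Ω : ℕ → Type*} [∀ n, MeasurableSpace (Ω n)] {M : Model p q r Ω}
  {H : Matrix (Fin p ⊕ Fin r) (Fin p ⊕ Fin r) ℝ}

lemma Dstar_mulVec_injective {C : Matrix (Fin r) (Fin q) ℝ} (hC : C.rank = q) :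
    Function.Injective (M.Dstar C).mulVec := by
  intro u v huv
  have h : ∀ u : Fin p ⊕ Fin q → ℝ,
      col (WithLp.toLp 2 (u ∘ Sum.inl), WithLp.toLp 2 (u ∘ Sum.inr)) = u := fun u => by
    ext i; rcases i with i | i <;> simp [col]
  have h2 := @linkDeriv_injective p q r Ω _ M C hC
    (WithLp.toLp 2 (u ∘ Sum.inl), WithLp.toLp 2 (u ∘ Sum.inr))
    (WithLp.toLp 2 (v ∘ Sum.inl), WithLp.toLp 2 (v ∘ Sum.inr))
    (by rw [linkDeriv_apply, linkDeriv_apply, h, h]; exact congrArg _ huv)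
  rw [← h u, ← h v, h2]

lemma posDef_J (hH : H.PosDef) {C : Matrix (Fin r) (Fin q) ℝ} (hC : C.rank = q) :
    (M.J H C).PosDef := by
  simpa [J] using hH.conjTranspose_mul_mul_same (B := M.Dstar C) (Dstar_mulVec_injective hC)

lemma posDef_J11 (hH : H.PosDef) (b : Vec (Fin q)) : (M.J11 H b).PosDef := by
  have hinj : Function.Injective (M.D1 b).mulVec := fun u v huv => by
    ext i
    simpa [D1, fromRows_mulVec] using congrFun huv (Sum.inl i)
  simpa [J11] using hH.conjTranspose_mul_mul_same (B := M.D1 b) hinj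

/-- The limit criterion `q^S` is the quadratic function of the reduced form at `D_* ψ`. -/
lemma qS_eq (hH : H.PosDef) {C : Matrix (Fin r) (Fin q) ℝ} (hC : C.rank = q)
    (y : Vec (Fin p ⊕ Fin r)) (ψ : Param p q) :
    M.qS H C y ψ = quad H y (M.linkDeriv C ψ) := by
  have hJ := posDef_J (M := M) hH hC
  have hZ : M.J H C *ᵥ M.Z H C y = -((M.Dstar C)ᵀ *ᵥ y.ofLp) := by
    rw [Z, mulVec_neg, mulVec_mulVec,
      mul_nonsing_inv _ ((Matrix.isUnit_iff_isUnit_det _).1 hJ.isUnit), one_mulVec]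
  rw [qS, complete_square hJ.1 hZ, quad, linkDeriv_apply, mulVec_transpose, ← dotProduct_mulVec,
    J, dotProduct_mulVec_conj]

lemma toLp_D1_mulVec_add (c : Vec (Fin q) → Vec (Fin r)) (a : Vec (Fin p)) (b : Vec (Fin q)) :
    WithLp.toLp 2 (M.D1 b *ᵥ a.ofLp + gvec c b)
      = stack a (matCLM (M.jacPi (M.θlim.1, b)) a + c b) := by
  ext i
  rcases i with i | i <;> simp [D1, gvec, stack, fromRows_mulVec, matCLM_apply]

/-- The limit criterion `q^W` is the quadratic function of the reduced form at
`D_1(β) ψ₁ + g(β)`. -/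
lemma qW_eq (hH : H.PosDef) (c : Vec (Fin q) → Vec (Fin r)) (y : Vec (Fin p ⊕ Fin r))
    (x : Param p q) :
    M.qW H c y x = quad H y (stack x.1 (matCLM (M.jacPi (M.θlim.1, x.2)) x.1 + c x.2)) := by
  have hJ := posDef_J11 (M := M) hH x.2
  have hZ : M.J11 H x.2 *ᵥ (M.Z1 H c y x.2).ofLp
      = -((M.D1 x.2)ᵀ *ᵥ (y.ofLp + H *ᵥ gvec c x.2)) := by
    rw [Z1, mulVec_neg, mulVec_mulVec,
      mul_nonsing_inv _ ((Matrix.isUnit_iff_isUnit_det _).1 hJ.isUnit), one_mulVec]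
  have h1 := complete_square hJ.1 hZ x.1.ofLp
  rw [mulVec_transpose, ← dotProduct_mulVec] at h1
  have h4 : x.1.ofLp ⬝ᵥ (M.J11 H x.2 *ᵥ x.1.ofLp) = _ := dotProduct_mulVec_conj _ _ _ _
  have h2 := dotProduct_mulVec_comm hH.1 (M.D1 x.2 *ᵥ x.1.ofLp) (gvec c x.2)
  have h3 : (H *ᵥ gvec c x.2) ⬝ᵥ (M.D1 x.2 *ᵥ x.1.ofLp)
      = (M.D1 x.2 *ᵥ x.1.ofLp) ⬝ᵥ (H *ᵥ gvec c x.2) := dotProduct_comm _ _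
  rw [← toLp_D1_mulVec_add, qW, qtW, quad]
  simp only [WithLp.ofLp_sub, mulVec_add, dotProduct_add, add_dotProduct] at h1 h2 ⊢
  linarith

lemma isUniqueMin_qW (hH : H.PosDef) {c : Vec (Fin q) → Vec (Fin r)} {y : Vec (Fin p ⊕ Fin r)}
    {B : Set (Vec (Fin q))} {b : Vec (Fin q)} (hb : IsUniqueMin (M.qtW H c y) B b) :
    IsUniqueMin (M.qW H c y) (Set.univ ×ˢ B) (M.Z1 H c y b, b) := by
  refine ⟨⟨trivial, hb.1⟩, fun x hx hne => ?_⟩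
  have h0 : M.qW H c y (M.Z1 H c y b, b) = M.qtW H c y b := by simp [qW]
  rw [h0]
  by_cases hxb : x.2 = b
  · have hx1 : (M.Z1 H c y x.2 - x.1).ofLp ≠ 0 := fun h => hne <| by
      have h' : M.Z1 H c y x.2 - x.1 = 0 := by ext i; exact congrFun h i
      exact Prod.ext (by rw [← hxb]; exact (sub_eq_zero.1 h').symm) hxb
    have := (posDef_J11 (M := M) hH x.2).dotProduct_mulVec_pos hx1
    simp only [star_trivial] at this
    rw [qW, ← hxb]
    linarith
  · have := (posDef_J11 (M := M) hH x.2).posSemidef.dotProduct_mulVec_nonneg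
      (M.Z1 H c y x.2 - x.1).ofLp
    simp only [star_trivial] at this
    have h2 := hb.2 x.2 hx.2 hxb
    rw [qW]
    linarith

lemma zero_mem_of_localLimit (hM : M.Framework) {a : ℕ → ℝ} {Ψ : Set (Param p q)}
    (hΨ : M.LocalLimit a Ψ) : (0 : Param p q) ∈ Ψ := by
  refine hΨ.limit.mem_of_tendsto hΨ.isClosed (n := id) (l := atTop) tendsto_id
    (v := fun _ => 0) tendsto_const_nhds (.of_forall fun n => ⟨M.θ n, hM.θ_mem n, ?_⟩)
  simp [rescale]

lemma exists_norm_le_norm_linkDeriv {C : Matrix (Fin r) (Fin q) ℝ} (hC : C.rank = q) :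
    ∃ K > 0, ∀ ψ : Param p q, ‖ψ‖ ≤ K * ‖M.linkDeriv C ψ‖ := by
  obtain ⟨K, hK, hlip⟩ := (M.linkDeriv C).toLinearMap.exists_antilipschitzWith
    (LinearMap.ker_eq_bot.2 (linkDeriv_injective hC))
  refine ⟨K, by exact_mod_cast hK, fun ψ => ?_⟩
  simpa using hlip.le_mul_dist ψ 0

lemma exists_isUniqueMin_qS (hH : H.PosDef) {C : Matrix (Fin r) (Fin q) ℝ} (hC : C.rank = q)
    {Ψ : Set (Param p q)} (hclosed : IsClosed Ψ) (hconv : Convex ℝ Ψ) (h0 : (0 : Param p q) ∈ Ψ)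
    (y : Vec (Fin p ⊕ Fin r)) : ∃ ψ, IsUniqueMin (M.qS H C y) Ψ ψ := by
  obtain ⟨c, hc, hcH⟩ := exists_pos_mul_sq_le hH
  obtain ⟨K, hK, hKD⟩ := exists_norm_le_norm_linkDeriv (M := M) hC
  have hq : M.qS H C y = fun ψ => quad H y (M.linkDeriv C ψ) := funext (qS_eq hH hC y)
  rw [hq]
  have hcont : Continuous fun ψ => quad H y (M.linkDeriv C ψ) :=
    (continuous_quad H).comp (continuous_const.prodMk (M.linkDeriv C).continuous)
  have hcoer : ∀ᶠ ψ in cocompact (Param p q) ⊓ 𝓟 Ψ,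
      quad H y (M.linkDeriv C 0) ≤ quad H y (M.linkDeriv C ψ) := by
    refine Eventually.filter_mono inf_le_left ?_
    filter_upwards [(tendsto_norm_cocompact_atTop (E := Param p q)).eventually_ge_atTop
      (K * (2 * ‖y‖ / c))] with ψ hψ
    set s := M.linkDeriv C ψ with hs
    have h1 : 2 * ‖y‖ / c ≤ ‖s‖ := le_of_mul_le_mul_left (hψ.trans (hKD ψ)) hK
    rw [div_le_iff₀ hc] at h1
    have h2 := (abs_le.1 (abs_dotProduct_le y s)).1
    have h3 := hcH s
    have h4 : quad H y (M.linkDeriv C 0) = 0 := by simp [quad]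
    rw [h4, quad]
    nlinarith [mul_le_mul_of_nonneg_right h1 (norm_nonneg s)]
  obtain ⟨ψ, hψ, hmin⟩ := hcont.continuousOn.exists_isMinOn' hclosed h0 hcoer
  refine ⟨ψ, hψ, fun φ hφ hne => lt_of_le_of_ne (isMinOn_iff.1 hmin φ hφ) fun heq => ?_⟩
  have hmid := isMinOn_iff.1 hmin _ (hconv hψ hφ (by norm_num : (0 : ℝ) ≤ 1 / 2)
    (by norm_num : (0 : ℝ) ≤ 1 / 2) (by norm_num))
  rw [map_add, map_smul, map_smul, quad_add_div_two hH.1] at hmid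
  replace heq : quad H y (M.linkDeriv C ψ) = quad H y (M.linkDeriv C φ) := heq
  have hDne : (M.linkDeriv C ψ - M.linkDeriv C φ).ofLp ≠ 0 := fun h => hne <| by
    have h' : M.linkDeriv C ψ - M.linkDeriv C φ = 0 := by ext i; exact congrFun h i
    exact (linkDeriv_injective hC (sub_eq_zero.1 h')).symm
  have hpos := hH.dotProduct_mulVec_pos hDne
  simp only [star_trivial] at hpos
  linarith

end Model

/-! ### Limits of the rescaled estimator -/

lemma exists_tendsto_ultrafilter {α E : Type*} [TopologicalSpace E] {K : Set E} (hK : IsCompact K)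
    {U : Ultrafilter α} {f : α → E} (hf : ∀ᶠ i in U, f i ∈ K) : ∃ x ∈ K, Tendsto f U (𝓝 x) :=
  hK.ultrafilter_le_nhds (U.map f) (le_principal_iff.2 hf)

lemma exists_tendsto_ultrafilter_of_norm_le {α E : Type*} [NormedAddCommGroup E] [ProperSpace E]
    {U : Ultrafilter α} {f : α → E} {K : ℝ} (hf : ∀ᶠ i in U, ‖f i‖ ≤ K) :
    ∃ x, Tendsto f U (𝓝 x) := by
  obtain ⟨x, -, hx⟩ := exists_tendsto_ultrafilter (isCompact_closedBall (0 : E) K)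
    (hf.mono fun i hi => mem_closedBall_zero_iff.2 hi)
  exact ⟨x, hx⟩

lemma tendsto_of_tendstoUniformlyOn {α X E : Type*} [TopologicalSpace X] [NormedAddCommGroup E]
    {F : ℕ → X → E} {f : X → E} {s : Set X} (hF : TendstoUniformlyOn F f atTop s) {x : X}
    (hf : ContinuousWithinAt f s x) {l : Filter α} {n : α → ℕ} (hn : Tendsto n l atTop)
    {z : α → X} (hz : Tendsto z l (𝓝 x)) (hzs : ∀ᶠ i in l, z i ∈ s) :
    Tendsto (fun i => F (n i) (z i)) l (𝓝 (f x)) := by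
  have h1 : Tendsto (fun i => f (z i)) l (𝓝 (f x)) :=
    hf.tendsto.comp (tendsto_nhdsWithin_iff.2 ⟨hz, hzs⟩)
  refine h1.congr_dist (Metric.tendsto_nhds.2 fun ε hε => ?_)
  filter_upwards [hn.eventually (Metric.tendstoUniformlyOn_iff.1 hF ε hε), hzs] with i hi hi'
  simpa using hi (z i) hi'

namespace Model

variable {p q r : ℕ} {Ω : ℕ → Type*} [∀ n, MeasurableSpace (Ω n)] {M : Model p q r Ω}
  {T : ∀ n, Ω n → Vec (Fin p ⊕ Fin r) → ℝ} {H : Matrix (Fin p ⊕ Fin r) (Fin p ⊕ Fin r) ℝ}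

lemma tendsto_inv_sqrt : Tendsto (fun n : ℕ => (√(n : ℝ))⁻¹) atTop (𝓝 0) :=
  tendsto_inv_atTop_zero.comp (Real.tendsto_sqrt_atTop.comp tendsto_natCast_atTop_atTop)

/-- If `√n (x - π_n)` converges, then `x` converges to `π_*`. -/
lemma tendsto_fst_of_rescaled (hM : M.Framework) {α : Type*} {l : Filter α} {n : α → ℕ}
    (hn : Tendsto n l atTop) {x : α → Vec (Fin p)} {v : Vec (Fin p)}
    (hx : Tendsto (fun i => √(n i : ℝ) • (x i - (M.θ (n i)).1)) l (𝓝 v)) :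
    Tendsto x l (𝓝 M.θlim.1) := by
  have h := ((tendsto_inv_sqrt.comp hn).smul hx).add (tendsto_fst_θ hM hn)
  rw [zero_smul, zero_add] at h
  refine h.congr' ?_
  filter_upwards [hn.eventually (eventually_ge_atTop 1)] with i hi
  have : √(n i : ℝ) ≠ 0 := (Real.sqrt_pos.2 (by exact_mod_cast hi)).ne'
  simp [smul_smul, inv_mul_cancel₀ this]

lemma tendsto_of_rescale (hM : M.Framework) {a : ℕ → ℝ} (ha : ∀ n, 0 < a n)
    (hslow : Tendsto (fun n : ℕ => a n / √n) atTop (𝓝 0)) {α : Type*} {l : Filter α} {n : α → ℕ}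
    (hn : Tendsto n l atTop) {x : α → Param p q} {v : Param p q}
    (hx : Tendsto (fun i => M.rescale a (n i) (x i)) l (𝓝 v)) :
    Tendsto x l (𝓝 M.θlim) := by
  have h1 : Tendsto (fun i => (x i).1) l (𝓝 M.θlim.1) :=
    tendsto_fst_of_rescaled hM hn ((continuous_fst.tendsto v).comp hx)
  have h2 := ((hslow.comp hn).smul ((continuous_snd.tendsto v).comp hx)).add (tendsto_snd_θ hM hn)
  rw [zero_smul, zero_add] at h2
  refine h1.prodMk_nhds (h2.congr' ?_)
  filter_upwards [hn.eventually (eventually_ge_atTop 1)] with i hi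
  have hs : √(n i : ℝ) ≠ 0 := (Real.sqrt_pos.2 (by exact_mod_cast hi)).ne'
  have : a (n i) / √(n i : ℝ) * (√(n i : ℝ) / a (n i)) = 1 := by
    have := (ha (n i)).ne'
    field_simp
  simp [rescale, smul_smul, this]

/-- Where the score converges to `y` and the estimator converges to the true parameter, the
rescaled estimator converges to the minimizer of the limit criterion at `y`. -/
lemma tendsto_rescale_estim (h : M.Conditions T H) {a : ℕ → ℝ} (ha : ∀ n, 0 < a n)
    (hslow : Tendsto (fun n : ℕ => a n / √n) atTop (𝓝 0)) {C : Matrix (Fin r) (Fin q) ℝ}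
    (hC : M.DerivLimit a C) (hrank : C.rank = q) {Ψ : Set (Param p q)} (hΨ : M.LocalLimit a Ψ)
    {l : Filter (Σ n, Ω n)} (hl : l ≤ probFilter M.P) {y : Vec (Fin p ⊕ Fin r)}
    (hy : Tendsto (M.score T) l (𝓝 y)) (hcons : Tendsto M.estim l (𝓝 M.θlim))
    {ψ : Param p q} (hψ : IsUniqueMin (M.qS H C y) Ψ ψ) :
    Tendsto (fun w => M.rescale a w.1 (M.estim w)) l (𝓝 ψ) := by
  rw [tendsto_iff_ultrafilter]
  intro U hU
  have hUP : (U : Filter (Σ n, Ω n)) ≤ probFilter M.P := hU.trans hl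
  have hn : Tendsto (Sigma.fst : (Σ n, Ω n) → ℕ) U atTop := tendsto_fst_probFilter.mono_left hUP
  have ho := isLittleO_dev h.framework h.smooth h.regular ha hC hn (hcons.mono_left hU)
  obtain ⟨K, hK⟩ := exists_norm_dev_estim_le h hUP (hy.mono_left hU)
  obtain ⟨L, hL, hLD⟩ := exists_norm_le_norm_linkDeriv (M := M) hrank
  have hbound : ∀ᶠ w in U, ‖M.rescale a w.1 (M.estim w)‖ ≤ 2 * L * K := by
    filter_upwards [hK, isLittleO_iff.1 ho (c := 1 / (2 * L)) (by positivity)] with w h1 h2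
    have h3 := hLD (M.rescale a w.1 (M.estim w))
    have h4 := norm_sub_norm_le (M.linkDeriv C (M.rescale a w.1 (M.estim w)))
      (M.dev w.1 (M.estim w))
    rw [norm_sub_rev] at h4
    have h5 : ‖M.linkDeriv C (M.rescale a w.1 (M.estim w))‖
        ≤ K + 1 / (2 * L) * ‖M.rescale a w.1 (M.estim w)‖ := by linarith
    have h6 := h3.trans (mul_le_mul_of_nonneg_left h5 hL.le)
    have h7 : L * (K + 1 / (2 * L) * ‖M.rescale a w.1 (M.estim w)‖)
        = L * K + ‖M.rescale a w.1 (M.estim w)‖ / 2 := by field_simp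
    linarith
  obtain ⟨ψ₀, hψ₀⟩ := exists_tendsto_ultrafilter_of_norm_le hbound
  have hmem : ψ₀ ∈ Ψ := hΨ.limit.mem_of_tendsto hΨ.isClosed hn hψ₀
    (.of_forall fun w => ⟨M.estim w, h.framework.est_mem _ _, rfl⟩)
  have hdev₀ : Tendsto (fun w => M.dev w.1 (M.estim w)) U (𝓝 (M.linkDeriv C ψ₀)) := by
    have h1 := (ho.trans_isBigO (hψ₀.isBigO_one ℝ)).tendsto_zero_of_tendsto
      (tendsto_const_nhds (x := (1 : ℝ)))
    simpa using h1.add (((M.linkDeriv C).continuous.tendsto ψ₀).comp hψ₀)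
  -- a deterministic competitor whose local parameter converges to the minimizer
  obtain ⟨u, hu, hulim⟩ := hΨ.limit.exists_tendsto hψ.1
  have hex : ∀ n, ∃ x, u n ∈ M.localSpace a n → x ∈ M.space ∧ M.rescale a n x = u n := by
    intro n
    by_cases hun : u n ∈ M.localSpace a n
    · obtain ⟨x, hx, hxu⟩ := hun
      exact ⟨x, fun _ => ⟨hx, hxu⟩⟩
    · exact ⟨0, fun h' => (hun h').elim⟩
  choose x hx using hex
  have hxlim : Tendsto (fun n => M.rescale a n (x n)) atTop (𝓝 ψ) :=
    hulim.congr' (hu.mono fun n hn' => ((hx n hn').2).symm)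
  have hox := isLittleO_dev h.framework h.smooth h.regular ha hC (n := id) tendsto_id
    (tendsto_of_rescale h.framework ha hslow (n := id) tendsto_id hxlim)
  have hdev₁ : Tendsto (fun n => M.dev n (x n)) atTop (𝓝 (M.linkDeriv C ψ)) := by
    have h1 := (hox.trans_isBigO (hxlim.isBigO_one ℝ)).tendsto_zero_of_tendsto
      (tendsto_const_nhds (x := (1 : ℝ)))
    simpa using h1.add (((M.linkDeriv C).continuous.tendsto ψ).comp hxlim)
  have hle := quad_le_quad h hUP (hy.mono_left hU) hdev₀ (hu.mono fun n hn' => (hx n hn').1) hdev₁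
  rw [← qS_eq h.posDef hrank, ← qS_eq h.posDef hrank] at hle
  have heq : ψ₀ = ψ := by
    by_contra hne
    exact absurd (hψ.2 ψ₀ hmem hne) (not_lt.2 hle)
  rwa [heq] at hψ₀

lemma tendsto_fst_estim (h : M.Conditions T H) :
    Tendsto (fun w => (M.estim w).1) (probFilter M.P) (𝓝 M.θlim.1) := by
  have h1 := tendsto_δ_estim h.framework h.smooth h.objective h.identified h.regular
  rw [tendsto_iff_norm_sub_tendsto_zero] at h1 ⊢
  refine squeeze_zero (fun _ => norm_nonneg _) (fun w => ?_) h1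
  rw [δ, δ, ← stack_sub]
  exact norm_fst_le_norm_stack _ _

lemma tendsto_τ_estim (h : M.Conditions T H) :
    Tendsto (fun w => M.τ (M.estim w)) (probFilter M.P) (𝓝 (M.τ M.θlim)) := by
  have h1 := tendsto_δ_estim h.framework h.smooth h.objective h.identified h.regular
  rw [tendsto_iff_norm_sub_tendsto_zero] at h1 ⊢
  refine squeeze_zero (fun _ => norm_nonneg _) (fun w => ?_) h1
  rw [δ, δ, ← stack_sub]
  exact norm_snd_le_norm_stack _ _

/-- Limit points of the estimator of `β` belong to the identified set. -/
lemma mem_space_of_tendsto (h : M.Conditions T H) {l : Filter (Σ n, Ω n)} [l.NeBot]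
    (hl : l ≤ probFilter M.P) {b : Vec (Fin q)}
    (hb : Tendsto (fun w => (M.estim w).2) l (𝓝 b)) : (M.θlim.1, b) ∈ M.space :=
  h.regular.isClosed.mem_of_tendsto (((tendsto_fst_estim h).mono_left hl).prodMk_nhds hb)
    (.of_forall fun _ => h.framework.est_mem _ _)

/-! ### Strong sequences -/

/-- Consistency of the estimator along strong sequences. -/
lemma Strong.tendsto_estim (hS : M.Strong) (h : M.Conditions T H) :
    Tendsto M.estim (probFilter M.P) (𝓝 M.θlim) := by
  rw [tendsto_iff_ultrafilter]
  intro U hU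
  have h1 := (tendsto_fst_estim h).mono_left hU
  obtain ⟨L, hL, N, hN, hlip⟩ := h.regular.lipschitz
  have hnear : ∀ᶠ w in U, (M.estim w).2 ∈ Metric.cthickening 1 M.identified := by
    have h0 : Tendsto (fun w => ENNReal.ofReal (L * ‖(M.estim w).1 - M.θlim.1‖)) U (𝓝 0) := by
      have := ENNReal.tendsto_ofReal
        ((tendsto_iff_norm_sub_tendsto_zero.1 h1).const_mul L)
      simpa using this
    filter_upwards [h1 hN, h0.eventually (ge_mem_nhds one_pos)] with w hw hw'
    refine Metric.mem_cthickening_iff.2 ?_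
    rw [ENNReal.ofReal_one]
    refine le_trans (Metric.infEDist_le_hausdorffEDist_of_mem
      (s := M.crossSection {(M.estim w).1}) ⟨_, rfl, h.framework.est_mem _ _⟩) ?_
    exact (hlip _ hw _ (mem_of_mem_nhds hN)).trans hw'
  obtain ⟨b, -, hb⟩ := exists_tendsto_ultrafilter h.regular.isCompact.cthickening hnear
  have hbs := mem_space_of_tendsto h hU hb
  have hτ : M.τ (M.θlim.1, b) = M.τ M.θlim :=
    tendsto_nhds_unique ((hasStrictFDerivAt_τ h.framework h.smooth
      (h.framework.mem_big hbs)).hasFDerivAt.continuousAt.tendsto.comp (h1.prodMk_nhds hb))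
      ((tendsto_τ_estim h).mono_left hU)
  have hbeq := hS.injective b ⟨_, rfl, hbs⟩ hτ
  rw [hbeq] at hb
  exact h1.prodMk_nhds hb

/-- Along strong sequences, continuity of `∂_β τ` gives the derivative limit with `a_n = 1`. -/
lemma derivLimit_one (h : M.Conditions T H) : M.DerivLimit (fun _ => 1) (M.jacBeta M.θlim) := by
  have h1 : Tendsto (fun z : ℕ × Vec (Fin q) => ((M.θ z.1).1, z.2)) (atTop ×ˢ 𝓝 M.θlim.2)
      (𝓝 M.θlim) := (tendsto_fst_θ h.framework tendsto_fst).prodMk_nhds tendsto_snd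
  refine tendsto_pi_nhds.2 fun i => tendsto_pi_nhds.2 fun j => ?_
  have h2 := ((continuousOn_jacBeta h.framework h.smooth i j).continuousAt
    (h.framework.isOpen_big.mem_nhds
      (h.framework.mem_big (θlim_mem h.framework h.regular)))).tendsto.comp h1
  refine h2.congr fun z => ?_
  simp

/-! ### Compact cross-sections and semi-strong sequences -/

lemma BaseNhd.eventually_mem {S : Set (Vec (Fin p))} (hS : M.BaseNhd S) (h : M.Conditions T H) :
    ∀ᶠ w in probFilter M.P, (M.estim w).2 ∈ M.crossSection S := by
  filter_upwards [tendsto_fst_estim h hS.mem_nhds] with w hw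
  exact ⟨_, hw, h.framework.est_mem _ _⟩

lemma BaseNhd.continuousOn_limit {S : Set (Vec (Fin p))} (hS : M.BaseNhd S)
    (h : M.Conditions T H) {a : ℕ → ℝ} {c : Vec (Fin q) → Vec (Fin r)}
    (hc : TendstoUniformlyOn (fun n b => a n • (M.τ ((M.θ n).1, b) - M.τ (M.θ n))) c atTop
      (M.crossSection S)) : ContinuousOn c (M.crossSection S) := by
  refine hc.continuousOn (Eventually.frequently ?_)
  filter_upwards [tendsto_fst_θ h.framework tendsto_id hS.mem_nhds] with n hn
  have h1 : ContinuousOn (fun b => M.τ ((M.θ n).1, b)) (M.crossSection S) :=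
    h.smooth.continuousOn.comp (by fun_prop) fun b hb => hS.prod_subset ⟨hn, hb⟩
  exact (h1.sub continuousOn_const).const_smul (a n)

/-- The contribution of the first parameter to the rescaled link, for `β` converging to an
arbitrary point of the domain. -/
lemma tendsto_τ_fst_sub (h : M.Conditions T H) {b : Vec (Fin q)} (hb : (M.θlim.1, b) ∈ M.big)
    {α : Type*} {l : Filter α} {n : α → ℕ} (hn : Tendsto n l atTop) {x : α → Param p q}
    {v : Vec (Fin p)} (hx1 : Tendsto (fun i => √(n i : ℝ) • ((x i).1 - (M.θ (n i)).1)) l (𝓝 v))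
    (hx2 : Tendsto (fun i => (x i).2) l (𝓝 b)) :
    Tendsto (fun i => √(n i : ℝ) • (M.τ (x i) - M.τ ((M.θ (n i)).1, (x i).2))) l
      (𝓝 (matCLM (M.jacPi (M.θlim.1, b)) v)) := by
  have e := (isBigO_refl (fun i => √(n i : ℝ)) l).smul_isLittleO
    (isLittleO_τ_fst h.framework h.smooth hb (tendsto_fst_of_rescaled h.framework hn hx1)
      (tendsto_fst_θ h.framework hn) hx2)
  have h1 := (e.trans_isBigO (hx1.isBigO_one ℝ)).tendsto_zero_of_tendsto
      (tendsto_const_nhds (x := (1 : ℝ)))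
  have h2 := h1.add (((matCLM (M.jacPi (M.θlim.1, b))).continuous.tendsto v).comp hx1)
  rw [zero_add] at h2
  refine h2.congr fun i => ?_
  rw [Function.comp_apply, ContinuousLinearMap.map_smul, smul_sub _ (_ - _), sub_add_cancel]

/-- Consistency of the estimator along semi-strong sequences, where the score converges. It rests
on the rate of the reduced-form parameters: `a_n (τ(est) - τ(θ_n))` vanishes because
`a_n = o(√n)`. -/
lemma SemiStrong.tendsto_estim {a : ℕ → ℝ} {S : Set (Vec (Fin p))}
    {c : Vec (Fin q) → Vec (Fin r)} {C : Vec (Fin q) → Matrix (Fin r) (Fin q) ℝ}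
    (hSS : M.SemiStrong a S c C) (hS : M.BaseNhd S) (h : M.Conditions T H)
    {l : Filter (Σ n, Ω n)} (hl : l ≤ probFilter M.P) {y : Vec (Fin p ⊕ Fin r)}
    (hy : Tendsto (M.score T) l (𝓝 y)) : Tendsto M.estim l (𝓝 M.θlim) := by
  rw [tendsto_iff_ultrafilter]
  intro U hU
  have hUP : (U : Filter (Σ n, Ω n)) ≤ probFilter M.P := hU.trans hl
  have hn : Tendsto (Sigma.fst : (Σ n, Ω n) → ℕ) U atTop := tendsto_fst_probFilter.mono_left hUP
  have h1 := (tendsto_fst_estim h).mono_left hUP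
  have hmem := (hS.eventually_mem h).filter_mono hUP
  obtain ⟨K, hK⟩ := exists_norm_dev_estim_le h hUP (hy.mono_left hU)
  obtain ⟨b, hbS, hb⟩ := exists_tendsto_ultrafilter hS.isCompact hmem
  have hbs := mem_space_of_tendsto h hUP hb
  obtain ⟨v, hv⟩ := exists_tendsto_ultrafilter_of_norm_le (E := Vec (Fin p)) <| hK.mono fun w hw =>
    le_trans (norm_fst_le_norm_stack _ _) ((M.dev_eq_stack _ _) ▸ hw)
  obtain ⟨t, ht⟩ := exists_tendsto_ultrafilter_of_norm_le (E := Vec (Fin r)) <| hK.mono fun w hw =>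
    le_trans (norm_snd_le_norm_stack _ _) ((M.dev_eq_stack _ _) ▸ hw)
  have hdiff := ht.sub (tendsto_τ_fst_sub h (h.framework.mem_big hbs) hn hv hb)
  have hzero := (hSS.slow.comp hn).smul hdiff
  rw [zero_smul] at hzero
  have hlim := tendsto_of_tendstoUniformlyOn hSS.unif
    (hS.continuousOn_limit h hSS.unif b hbS) hn hb hmem
  have hcb : c b = 0 := by
    refine tendsto_nhds_unique (hlim.congr' ?_) hzero
    filter_upwards [hn.eventually (eventually_ge_atTop 1)] with w hw
    have hs : √(w.1 : ℝ) ≠ 0 := (Real.sqrt_pos.2 (by exact_mod_cast hw)).ne'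
    rw [Function.comp_apply, ← smul_sub, smul_smul, div_mul_cancel₀ _ hs, sub_sub_sub_cancel_left]
  have hbeq := hSS.injective b hbS hcb
  rw [hbeq] at hb
  exact h1.prodMk_nhds hb

lemma SemiStrong.derivLimit {a : ℕ → ℝ} {S : Set (Vec (Fin p))}
    {c : Vec (Fin q) → Vec (Fin r)} {C : Vec (Fin q) → Matrix (Fin r) (Fin q) ℝ}
    (hSS : M.SemiStrong a S c C) (h : M.Conditions T H) : M.DerivLimit a (C M.θlim.2) := by
  obtain ⟨N, hN, hunif⟩ := hSS.unif_deriv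
  have hθlim := h.framework.mem_big (θlim_mem h.framework h.regular)
  obtain ⟨A, hA, B, hB, hAB⟩ := mem_nhds_prod_iff.1 (h.framework.isOpen_big.mem_nhds hθlim)
  refine tendsto_pi_nhds.2 fun i => tendsto_pi_nhds.2 fun j => ?_
  have hunif' := (hunif i j).mono (Set.inter_subset_left (t := B))
  have hcont : ContinuousOn (fun b => C b i j) (N ∩ B) := by
    refine hunif'.continuousOn (Eventually.frequently ?_)
    filter_upwards [tendsto_fst_θ h.framework tendsto_id hA] with n hn
    refine continuousOn_const.mul ?_
    exact (continuousOn_jacBeta h.framework h.smooth i j).comp (f := fun b => ((M.θ n).1, b))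
      (by fun_prop) fun b hb => hAB ⟨hn, hb.2⟩
  exact tendsto_of_tendstoUniformlyOn hunif'
    (hcont _ (mem_of_mem_nhds (inter_mem hN hB))) tendsto_fst tendsto_snd
    (tendsto_snd (inter_mem hN hB))

/-! ### Weak sequences -/

/-- The limit of the reduced-form deviation along weak sequences. -/
lemma Weak.tendsto_dev {S : Set (Vec (Fin p))} {c : Vec (Fin q) → Vec (Fin r)}
    (hW : M.Weak S c) (hS : M.BaseNhd S) (h : M.Conditions T H) {b : Vec (Fin q)}
    (hb : (M.θlim.1, b) ∈ M.big) (hbS : b ∈ M.crossSection S)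
    {α : Type*} {l : Filter α} {n : α → ℕ} (hn : Tendsto n l atTop) {x : α → Param p q}
    {v : Vec (Fin p)} (hx1 : Tendsto (fun i => √(n i : ℝ) • ((x i).1 - (M.θ (n i)).1)) l (𝓝 v))
    (hx2 : Tendsto (fun i => (x i).2) l (𝓝 b)) (hxS : ∀ᶠ i in l, (x i).2 ∈ M.crossSection S) :
    Tendsto (fun i => M.dev (n i) (x i)) l
      (𝓝 (stack v (matCLM (M.jacPi (M.θlim.1, b)) v + c b))) := by
  have h1 := tendsto_of_tendstoUniformlyOn hW (hS.continuousOn_limit h hW b hbS) hn hx2 hxS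
  have h2 := (tendsto_τ_fst_sub h hb hn hx1 hx2).add h1
  refine ((continuous_stack.tendsto _).comp (hx1.prodMk_nhds h2)).congr fun i => ?_
  rw [Function.comp_apply, dev_eq_stack, ← smul_add, sub_add_sub_cancel]

/-- Every point of the identified set is a limit of second components of parameters in `Θ` whose
first components have the prescribed local parameter `v` in the limit. This is where the Lipschitz
property of the cross-sections is used. -/
lemma exists_competitor (h : M.Conditions T H) {b : Vec (Fin q)} (hb : b ∈ M.identified)
    (v : Vec (Fin p)) : ∃ x : ℕ → Param p q, (∀ᶠ n in atTop, x n ∈ M.space) ∧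
      Tendsto (fun n : ℕ => √(n : ℝ) • ((x n).1 - (M.θ n).1)) atTop (𝓝 v) ∧
      Tendsto (fun n => (x n).2) atTop (𝓝 b) := by
  obtain ⟨L, hL, N, hN, hlip⟩ := h.regular.lipschitz
  let π : ℕ → Vec (Fin p) := fun n => (M.θ n).1 + (√(n : ℝ))⁻¹ • v
  have hπ' : Tendsto (fun n : ℕ => √(n : ℝ) • (π n - (M.θ n).1)) atTop (𝓝 v) := by
    refine tendsto_const_nhds.congr' ?_
    filter_upwards [eventually_ge_atTop 1] with n hn
    have hs : √(n : ℝ) ≠ 0 := (Real.sqrt_pos.2 (by exact_mod_cast hn)).ne'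
    simp [π, smul_smul, mul_inv_cancel₀ hs]
  have hπ : Tendsto π atTop (𝓝 M.θlim.1) :=
    tendsto_fst_of_rescaled h.framework (n := id) tendsto_id hπ'
  have hdist : Tendsto (fun n => Metric.infEDist b (M.crossSection {π n})) atTop (𝓝 0) := by
    have h0 : Tendsto (fun n => ENNReal.ofReal (L * ‖M.θlim.1 - π n‖)) atTop (𝓝 0) := by
      have h1 := (tendsto_const_nhds (x := M.θlim.1)).sub hπ
      simpa using ENNReal.tendsto_ofReal (h1.norm.const_mul L)
    refine tendsto_of_tendsto_of_tendsto_of_le_of_le' tendsto_const_nhds h0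
      (.of_forall fun _ => zero_le) ?_
    filter_upwards [hπ hN] with n hn
    exact (Metric.infEDist_le_hausdorffEDist_of_mem hb).trans (hlip _ (mem_of_mem_nhds hN) _ hn)
  obtain ⟨u, hu, hub⟩ := exists_tendsto_of_infEDist hdist
  refine ⟨fun n => (π n, u n), hu.mono fun n hn => ?_, hπ', hub⟩
  obtain ⟨a, ha, hau⟩ := hn
  rwa [Set.mem_singleton_iff.1 ha] at hau

/-- Along weak sequences, where the score converges to `y`, the estimator converges to the minimizer
of the limit criterion at `y`. -/
lemma Weak.tendsto_estim {S : Set (Vec (Fin p))} {c : Vec (Fin q) → Vec (Fin r)}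
    (hW : M.Weak S c) (hS : M.BaseNhd S) (h : M.Conditions T H)
    {l : Filter (Σ n, Ω n)} (hl : l ≤ probFilter M.P) {y : Vec (Fin p ⊕ Fin r)}
    (hy : Tendsto (M.score T) l (𝓝 y)) {x₀ : Param p q}
    (hx₀ : IsUniqueMin (M.qW H c y) (Set.univ ×ˢ M.identified) x₀) :
    Tendsto (fun w : Σ n, Ω n => ((√(w.1 : ℝ) • ((M.estim w).1 - (M.θ w.1).1), (M.estim w).2) :
      Param p q)) l (𝓝 x₀) := by
  rw [tendsto_iff_ultrafilter]
  intro U hU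
  have hUP : (U : Filter (Σ n, Ω n)) ≤ probFilter M.P := hU.trans hl
  have hn : Tendsto (Sigma.fst : (Σ n, Ω n) → ℕ) U atTop := tendsto_fst_probFilter.mono_left hUP
  have hmem := (hS.eventually_mem h).filter_mono hUP
  obtain ⟨K, hK⟩ := exists_norm_dev_estim_le h hUP (hy.mono_left hU)
  obtain ⟨b, hbS, hb⟩ := exists_tendsto_ultrafilter hS.isCompact hmem
  have hbs := mem_space_of_tendsto h hUP hb
  obtain ⟨v, hv⟩ := exists_tendsto_ultrafilter_of_norm_le (E := Vec (Fin p)) <| hK.mono fun w hw =>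
    le_trans (norm_fst_le_norm_stack _ _) ((M.dev_eq_stack _ _) ▸ hw)
  have hdev₀ := hW.tendsto_dev hS h (h.framework.mem_big hbs) hbS hn hv hb hmem
  obtain ⟨x, hx, hx1, hx2⟩ := exists_competitor h hx₀.1.2 x₀.1
  obtain ⟨a, ha, has⟩ := hx₀.1.2
  rw [Set.mem_singleton_iff.1 ha] at has
  have hxS : ∀ᶠ n in atTop, (x n).2 ∈ M.crossSection S := by
    filter_upwards [hx, tendsto_fst_of_rescaled h.framework (n := id) tendsto_id hx1 hS.mem_nhds]
      with n hn' hn''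
    exact ⟨_, hn'', hn'⟩
  have hdev₁ := hW.tendsto_dev hS h (h.framework.mem_big has)
    ⟨_, mem_of_mem_nhds hS.mem_nhds, has⟩ (n := id) tendsto_id hx1 hx2 hxS
  have hle := quad_le_quad h hUP (hy.mono_left hU) hdev₀ hx hdev₁
  have e₀ := M.qW_eq h.posDef c y (v, b)
  have e₁ := M.qW_eq h.posDef c y x₀
  rw [← e₀, ← e₁] at hle
  have heq : (v, b) = x₀ := by
    by_contra hne
    exact absurd (hx₀.2 (v, b) ⟨trivial, _, rfl, hbs⟩ hne) (not_lt.2 hle)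
  rw [← heq]
  exact hv.prodMk_nhds hb

end Model

end MinDist

end

/-! ### The limit theorem -/

theorem theorem1 {p q r : ℕ} {Ω : ℕ → Type*} [∀ n, MeasurableSpace (Ω n)]
    {Ω' : Type*} [MeasurableSpace Ω'] (P' : Measure Ω') [IsProbabilityMeasure P']
    (M : MinDist.Model p q r Ω) (T : ∀ n, Ω n → MinDist.Vec (Fin p ⊕ Fin r) → ℝ)
    (Y : Ω' → MinDist.Vec (Fin p ⊕ Fin r)) (V H : Matrix (Fin p ⊕ Fin r) (Fin p ⊕ Fin r) ℝ)
    (hM : M.Framework)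
    (hsmooth : M.SmoothLink)
    (hobj : M.ReducedFormObjective T)
    (hident : M.ReducedFormIdentified T)
    (hspace : M.RegularSpace)
    (hquad : M.QuadraticExpansion T)
    (hlim : M.ReducedFormLimits T P' Y V H) :
    -- strong sequences
    (M.Strong → ∀ Ψ : Set (MinDist.Param p q), M.LocalLimit (fun _ => 1) Ψ →
      ∃ ψ : Ω' → MinDist.Param p q,
        (∀ ω, MinDist.IsUniqueMin (M.qS H (M.jacBeta M.θlim) (Y ω)) Ψ (ψ ω)) ∧
        TendstoInDistribution (fun (n : ℕ) ω => √n • (M.est n ω - M.θ n)) atTop ψ M.P P') ∧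
    -- semi-strong sequences
    (∀ (a : ℕ → ℝ) (S : Set (MinDist.Vec (Fin p)))
      (c : MinDist.Vec (Fin q) → MinDist.Vec (Fin r))
      (C : MinDist.Vec (Fin q) → Matrix (Fin r) (Fin q) ℝ),
      M.BaseNhd S → M.SemiStrong a S c C →
      ∀ Ψ : Set (MinDist.Param p q), M.LocalLimit a Ψ →
      ∃ ψ : Ω' → MinDist.Param p q,
        (∀ ω, MinDist.IsUniqueMin (M.qS H (C M.θlim.2) (Y ω)) Ψ (ψ ω)) ∧
        TendstoInDistribution
          (fun (n : ℕ) ω => ((√n • ((M.est n ω).1 - (M.θ n).1),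
            (√n / a n) • ((M.est n ω).2 - (M.θ n).2)) : MinDist.Param p q))
          atTop ψ M.P P') ∧
    -- weak sequences
    (∀ (S : Set (MinDist.Vec (Fin p))) (c : MinDist.Vec (Fin q) → MinDist.Vec (Fin r)),
      M.BaseNhd S → M.Weak S c →
      (∀ᵐ ω ∂P', ∃ b, MinDist.IsUniqueMin (M.qtW H c (Y ω)) M.identified b) →
      ∃ βmin : Ω' → MinDist.Vec (Fin q),
        (∀ᵐ ω ∂P', MinDist.IsUniqueMin (M.qtW H c (Y ω)) M.identified (βmin ω)) ∧
        (∀ᵐ ω ∂P', MinDist.IsUniqueMin (M.qW H c (Y ω)) (Set.univ ×ˢ M.identified)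
          (M.Z1 H c (Y ω) (βmin ω), βmin ω)) ∧
        TendstoInDistribution
          (fun (n : ℕ) ω => ((√n • ((M.est n ω).1 - (M.θ n).1),
            (M.est n ω).2) : MinDist.Param p q))
          atTop (fun ω => (M.Z1 H c (Y ω) (βmin ω), βmin ω)) M.P P') := by
  have hcond : M.Conditions T H := ⟨hM, hsmooth, hobj, hident, hspace, hquad, hlim.posDef_H,
    hlim.hess⟩
  -- the score converges along the filter that restricts it to be near `Y ω`
  have hscore : ∀ y, Tendsto (M.score T) (MinDist.probFilter M.P ⊓
      comap (fun w : Σ n, Ω n => √(w.1 : ℝ) • gradient (T w.1 w.2) (M.δ (M.θ w.1))) (𝓝 y)) (𝓝 y) :=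
    fun y => tendsto_comap.mono_left inf_le_right
  refine ⟨fun hS Ψ hΨ => ?_, fun a S c C hS hSS Ψ hΨ => ?_, fun S c hS hW hmin => ?_⟩
  · have hex := MinDist.Model.exists_isUniqueMin_qS (M := M) hlim.posDef_H hS.rank hΨ.isClosed
      hΨ.convex (MinDist.Model.zero_mem_of_localLimit hM hΨ)
    choose ψ hψ using hex
    refine ⟨fun ω => ψ (Y ω), fun ω => hψ (Y ω), ?_⟩
    refine MinDist.tendstoInDistribution_of_tendsto hlim.score
      (fun n => Measurable.aemeasurable ?_) (.of_forall fun ω => ?_)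
    · have := hM.est_measurable n
      fun_prop
    have h := MinDist.Model.tendsto_rescale_estim hcond (fun _ => one_pos)
      (by simpa using MinDist.Model.tendsto_inv_sqrt) (MinDist.Model.derivLimit_one hcond) hS.rank
      hΨ inf_le_left (hscore (Y ω)) ((hS.tendsto_estim hcond).mono_left inf_le_left) (hψ (Y ω))
    refine h.congr fun w => ?_
    simp only [MinDist.Model.rescale, MinDist.Model.estim, div_one]
    rfl
  · have hex := MinDist.Model.exists_isUniqueMin_qS (M := M) hlim.posDef_H hSS.rank hΨ.isClosed
      hΨ.convex (MinDist.Model.zero_mem_of_localLimit hM hΨ)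
    choose ψ hψ using hex
    refine ⟨fun ω => ψ (Y ω), fun ω => hψ (Y ω), ?_⟩
    refine MinDist.tendstoInDistribution_of_tendsto hlim.score
      (fun n => Measurable.aemeasurable ?_) (.of_forall fun ω => ?_)
    · have := hM.est_measurable n
      fun_prop
    exact MinDist.Model.tendsto_rescale_estim hcond hSS.pos hSS.slow (hSS.derivLimit hcond) hSS.rank
      hΨ inf_le_left (hscore (Y ω)) (hSS.tendsto_estim hS hcond inf_le_left (hscore (Y ω)))
      (hψ (Y ω))
  · classical
    -- off the almost sure event the value of the minimizer is arbitrary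
    let β : MinDist.Vec (Fin p ⊕ Fin r) → MinDist.Vec (Fin q) := fun y =>
      if h : ∃ b, MinDist.IsUniqueMin (M.qtW H c y) M.identified b then h.choose else 0
    have hβ : ∀ᵐ ω ∂P', MinDist.IsUniqueMin (M.qtW H c (Y ω)) M.identified (β (Y ω)) := by
      filter_upwards [hmin] with ω hω
      simp only [β, dif_pos hω]
      exact hω.choose_spec
    have hβ' : ∀ᵐ ω ∂P', MinDist.IsUniqueMin (M.qW H c (Y ω)) (Set.univ ×ˢ M.identified)
        (M.Z1 H c (Y ω) (β (Y ω)), β (Y ω)) :=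
      hβ.mono fun ω hω => MinDist.Model.isUniqueMin_qW hlim.posDef_H hω
    refine ⟨fun ω => β (Y ω), hβ, hβ', ?_⟩
    refine MinDist.tendstoInDistribution_of_tendsto (h := fun y => (M.Z1 H c y (β y), β y))
      hlim.score (fun n => Measurable.aemeasurable ?_) (hβ'.mono fun ω hω => ?_)
    · have := hM.est_measurable n
      fun_prop
    exact hW.tendsto_estim hS hcond inf_le_left (hscore (Y ω)) hω
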